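/- **Setting.** Let $\mathsf S,\mathsf A$ be separable metric spaces with their Borel $\sigma$-algebras, $\mathsf E$ a measurable space with a probability measure $\mathcal P_{\mathsf E}$, and $H\in\mathbb N$. Let $\rho((x,a),(x',a'))=\|(\rho_{\mathsf S}(x,x'),\rho_{\mathsf A}(a,a'))\|$ for a norm $\|\cdot\|$ on $\mathbb R^2$ such that $\rho$ is a metric on $\mathsf S\times\mathsf A$. Consider the Markov decision process with horizon $H$, dynamics $S_h=\mathcal K_h(S_{h-1},A_{h-1},\varepsilon_h)$, $1\le h\le H$, with $\varepsilon_h\sim\mathcal P_{\mathsf E}$ i.i.d., transition kernels $P_h(\cdot|x,a)=\mathrm{Law}(\mathcal K_h(x,a,\varepsilon))$, measurable rewards $R_h:\mathsf S\times\mathsf A\to\mathbb R$, $0\le h<H$, and terminal reward $F:\mathsf S\to\mathbb R$. Let $$V_h^\star(x)=\sup_{\boldsymbol\pi}\mathbb E_{\boldsymbol\pi}\Big[\sum_{s=h}^{H-1}R_s(S_s,A_s)+F(S_H)\,\Big|\,S_h=x\Big],$$ the supremum being over randomized Markov policies. **Primal algorithm.** Let $\mu_0,\dots,\mu_H$ be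 probability measures on $\mathsf S$ with $P_h(\cdot|x,a)\ll\mu_h$ for $1\le h\le H$ and all $(x,a)$. Let $\boldsymbol\gamma=(\gamma_1,\dots,\gamma_{K_{\rm pr}})^\top$ be functions on $\mathsf S$ such that $\Sigma_h=\mathbb E_{X\sim\mu_h}[\boldsymbol\gamma(X)\boldsymbol\gamma(X)^\top]$ is invertible for $0\le h<H$. With independent $X_i^h\sim\mu_h$, $\varepsilon_i^h\sim\mathcal P_{\mathsf E}$ ($0\le h<H$, $1\le i\le N$), set $V_{H,N}=F$ and, for $h<H$, $$V_{h,N}(x)=\sup_{a}\Big(R_h(x,a)+\max\big(-\widetilde L_{h+1},\min(\widetilde L_{h+1},\beta_{N,a}^\top\boldsymbol\gamma(x))\big)\Big),\qquad \beta_{N,a}=\frac1N\sum_{i=1}^N V_{h+1,N}(\mathcal K_{h+1}(X_i^h,a,\varepsilon_i^h))\,\Sigma_h^{-1}\boldsymbol\gamma(X_i^h),$$ where $\widetilde L_h=(H-h+1)R_{\max}$. Put $V^\star_{\max}=(H+1)R_{\max}$ and $L_V=L_R+V^\star_{\max}\Lambda_\gamma L_\gamma\sqrt{K_{\rm pr}}$.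 **Dual algorithm.** Let $\boldsymbol\psi=(\psi_1,\dots,\psi_K)^\top$ be measurable functions on $\mathsf E$ with $\int\psi_k\,d\mathcal P_{\mathsf E}=0$ and $\Sigma_{\mathsf E}=\mathbb E[\boldsymbol\psi(\varepsilon)\boldsymbol\psi(\varepsilon)^\top]$ invertible. For $0\le t<H$ let $\mathbf c_K(x,a)$ be the minimizer of $\mathbf c\mapsto\mathbb E[(V^\star_{t+1}(\mathcal K_{t+1}(x,a,\varepsilon))-\mathbf c^\top\boldsymbol\psi(\varepsilon))^2]$ over $\mathbb R^K$, and $\eta_{t+1,K}(x,a,\varepsilon)=\mathbf c_K(x,a)^\top\boldsymbol\psi(\varepsilon)$. With independent draws $\widetilde\varepsilon_m^{t+1}\sim\mathcal P_{\mathsf E}$ ($1\le m\le M$), independent of the primal sample, let $$\mathbf c_{K,M}(x,a)=\frac1M\sum_{m=1}^M V_{t+1,N}(\mathcal K_{t+1}(x,a,\widetilde\varepsilon_m^{t+1}))\,\Sigma_{\mathsf E}^{-1}\boldsymbol\psi(\widetilde\varepsilon_m^{t+1}).$$ Let $\mathsf S_L=\{x_1,\dots,x_L\}\subset\mathsf S$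 and $\mathsf A_L=\{a_1,\dots,a_L\}\subset\mathsf A$ be fixed grids, $\mathcal L=L_VL_{\mathcal K}\Lambda_\psi$, and let $$I[f](p)=\tfrac12\Big(\max_{q\in\mathsf S_L\times\mathsf A_L}(f(q)-\mathcal L\rho(p,q))+\min_{q\in\mathsf S_L\times\mathsf A_L}(f(q)+\mathcal L\rho(p,q))\Big)$$ be the optimal central interpolant. Set $\widetilde\eta_{t+1,K,M}(x,a,\varepsilon)=\sum_{k=1}^K I[c_{k,M}](x,a)\,\psi_k(\varepsilon)$. Let $\rho_L=\sup_{p\in\mathsf S\times\mathsf A}\min_{q\in\mathsf S_L\times\mathsf A_L}\rho(p,q)$ be the covering radius and $\mathsf P$ the law of the whole (primal and dual) sample. **Assumptions.** $N,M,L,K,K_{\rm pr}\ge1$, and for nonnegative constants $R_{\max},L_R,L_{\mathcal K},L_\gamma,\Lambda_\gamma,\Lambda_\psi,\varrho_\psi$: * $\mathcal K_h$ is measurable and $\rho_{\mathsf S}(\mathcal K_h(x,a,\varepsilon),\mathcal K_h(x',a',\varepsilon))\le L_{\mathcal K}\,\rho((x,a),(x',a'))$; * $|R_h|\le R_{\max}$,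 $|F|\le R_{\max}$, $\sup_a|R_h(x,a)-R_h(x',a)|\le L_R\,\rho_{\mathsf S}(x,x')$, and $|F(x)-F(x')|\le L_V\,\rho_{\mathsf S}(x,x')$; * $|\Sigma_h^{-1}\boldsymbol\gamma(x)|_\infty\le\Lambda_\gamma$ for all $x$ and $0\le h<H$, and $|\boldsymbol\gamma(x)-\boldsymbol\gamma(x')|\le L_\gamma\,\rho_{\mathsf S}(x,x')$ in the Euclidean norm; * $|\Sigma_{\mathsf E}^{-1}\boldsymbol\psi(\varepsilon)|_\infty\le\Lambda_\psi$ for all $\varepsilon$, and $\mathbb E|\boldsymbol\psi(\varepsilon)|^2\le\varrho_\psi^2$. **Theorem.** There is an absolute constant $C$ such that in every such setting, for every $0\le t<H$, $$\mathbb E_{\mathcal P_{\mathsf E}\otimes\mathsf P}\Big[\sup_{(x,a)\in\mathsf S\times\mathsf A}|\eta_{t+1,K}(x,a,\cdot)-\widetilde\eta_{t+1,K,M}(x,a,\cdot)|^2\Big]\le C\Big(\varrho_\psi^2\,\frac{K\,(L_VL_{\mathcal K}I_{\mathcal D}+L_VL_{\mathcal K}\mathsf D+V^\star_{\max})^2\Lambda_\psi^2}{M}$$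 $$+\;K\Lambda_\psi^2\varrho_\psi^2\,\sup_{(x,a)}\Big\|\frac{dP_{t+1}(\cdot|x,a)}{d\mu_{t+1}}\Big\|_\infty\,\|V^\star_{t+1}-V_{t+1,N}\|^2_{L^2(\mu_{t+1}\otimes\mathsf P)}\;+\;K\varrho_\psi^2L_V^2L_{\mathcal K}^2\Lambda_\psi^2\,\rho_L^2\Big),$$ where $\mathsf D$ is the diameter of $\mathsf S\times\mathsf A$ with respect to $\rho$, $I_{\mathcal D}=\int_0^{\mathsf D}\sqrt{\log\mathcal N(\mathsf S\times\mathsf A,\rho,u)}\,du$ with $\mathcal N$ the covering number by balls of radius $u$, and $\|\cdot\|_\infty$ is the $\mu_{t+1}$-essential supremum. All quantities on the right take values in $[0,\infty]$, with $0\cdot\infty=0$. -/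

import Mathlib

open MeasureTheory ProbabilityTheory
open scoped NNReal ENNReal

noncomputable section

/-- The data: a finite horizon Markov decision process driven by random iterative functions,
together with the parameters of the primal and of the dual regression algorithm.
Objects indexed by `ℕ` are times; only times between `0` and `H` matter. -/
structure DualSetup (S A E : Type*) [MeasurableSpace S] [MeasurableSpace E] where
  /-- horizon -/
  H : ℕ
  /-- rewards `R_h(x, a)`, `0 ≤ h < H` -/
  R : ℕ → S → A → ℝ
  /-- terminal reward -/
  F : S → ℝ
  /-- the maps `𝒦_h((x, a), ε)`, `1 ≤ h ≤ H`, with `S_h = 𝒦_h(S_{h-1}, a_{h-1}, ε_h)` -/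
  dyn : ℕ → S × A → E → S
  /-- the law of the noise variables `ε_h` -/
  noise : Measure E
  /-- the norm on `ℝ²` that combines the two metrics -/
  nrm : Seminorm ℝ (ℝ × ℝ)
  /-- reference measures `μ_h`, `0 ≤ h ≤ H` -/
  μ : ℕ → Measure S
  /-- number of basis functions in the primal algorithm -/
  Kpr : ℕ
  /-- basis functions of the primal algorithm -/
  γ : Fin Kpr → S → ℝ
  /-- number of samples (per time step) in the primal algorithm -/
  N : ℕ
  /-- number of basis functions in the dual algorithm -/
  K : ℕ
  /-- basis functions of the dual algorithm -/
  ψ : Fin K → E → ℝ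
  /-- number of samples (per time step) in the dual algorithm -/
  M : ℕ
  /-- size of each of the two grids -/
  L : ℕ
  /-- grid in the state space -/
  gridS : Fin L → S
  /-- grid in the action space -/
  gridA : Fin L → A
  /-- bound of the rewards -/
  Rmax : ℝ≥0
  /-- Lipschitz constant of the rewards in the state -/
  LR : ℝ≥0
  /-- Lipschitz constant of the maps `𝒦_h` -/
  LK : ℝ≥0
  /-- Lipschitz constant of the primal basis -/
  Lγ : ℝ≥0
  /-- bound of `|Σ_h⁻¹ γ(x)|_∞` -/
  Λγ : ℝ≥0
  /-- bound of `|Σ_E⁻¹ ψ(ε)|_∞` -/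
  Λψ : ℝ≥0
  /-- bound of the root mean square of `|ψ(ε)|` -/
  ϱψ : ℝ≥0

namespace DualSetup

section Algorithm

variable {S A E : Type*} [MeasurableSpace S] [MeasurableSpace A] [MeasurableSpace E]

/-- The transition kernel: `P_h(· | x, a)` is the law of `𝒦_h(x, a, ε)`. -/
def transition (D : DualSetup S A E) (h : ℕ) : Kernel (S × A) S :=
  ((Kernel.id : Kernel (S × A) (S × A)) ×ₖ Kernel.const (S × A) D.noise).map
    (fun z => D.dyn h z.1 z.2)

/-- Randomized Markov policies. -/
def Policy (S A : Type*) [MeasurableSpace S] [MeasurableSpace A] : Type _ :=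
  {π : ℕ → Kernel S A // ∀ t, IsMarkovKernel (π t)}

/-- `D.pathKernel π n h x` is the law of `((S_h, A_h), …, (S_{h+n-1}, A_{h+n-1}), S_{h+n})`
for the process that is controlled by `π` and starts at time `h` in `S_h = x`. -/
def pathKernel (D : DualSetup S A E) (π : Policy S A) :
    (n h : ℕ) → Kernel S ((Fin n → S × A) × S)
  | 0, _ => Kernel.deterministic (fun x => (Fin.elim0, x)) (by fun_prop)
  | n + 1, h =>
      ((Kernel.id ×ₖ π.1 h) ⊗ₖ
        Kernel.prodMkLeft S (pathKernel D π n (h + 1) ∘ₖ D.transition (h + 1))).map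
        (fun z => (Fin.cons (α := fun _ => S × A) z.1 z.2.1, z.2.2))

/-- The value function `V_h^π(x)` of a policy: the expected reward from time `h` on,
given `S_h = x`. -/
def policyValue (D : DualSetup S A E) (π : Policy S A) (h : ℕ) (x : S) : ℝ :=
  ∫ z, ((∑ i : Fin (D.H - h), D.R (h + i) (z.1 i).1 (z.1 i).2) + D.F z.2)
    ∂(D.pathKernel π (D.H - h) h x)

/-- The optimal value function `V_h^⋆(x)`. -/
def Vstar (D : DualSetup S A E) (h : ℕ) (x : S) : ℝ :=
  ⨆ π : Policy S A, D.policyValue π h x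

/-- `V_max^⋆ = (H + 1) R_max`. -/
def Vmax (D : DualSetup S A E) : ℝ≥0 := (D.H + 1) * D.Rmax

/-- The clipping level `(H - h + 1) R_max`. -/
def clipLevel (D : DualSetup S A E) (h : ℕ) : ℝ := ((D.H : ℝ) - h + 1) * D.Rmax

/-- The Lipschitz constant `L_V = L_R + V_max^⋆ Λ_γ L_γ √K_pr` of the approximate value
functions. -/
def LV (D : DualSetup S A E) : ℝ≥0 :=
  D.LR + D.Vmax * D.Λγ * D.Lγ * NNReal.sqrt D.Kpr

/-- The matrix `Σ_h = E_{X ∼ μ_h}[γ(X) γ(X)ᵀ]`. -/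
def gramγ (D : DualSetup S A E) (h : ℕ) : Matrix (Fin D.Kpr) (Fin D.Kpr) ℝ :=
  Matrix.of fun i j => ∫ x, D.γ i x * D.γ j x ∂(D.μ h)

/-- The vector `Σ_h⁻¹ γ(x)`. -/
def normγ (D : DualSetup S A E) (h : ℕ) (x : S) : Fin D.Kpr → ℝ :=
  (D.gramγ h)⁻¹.mulVec fun k => D.γ k x

/-- The matrix `Σ_E = E[ψ(ε) ψ(ε)ᵀ]`. -/
def gramψ (D : DualSetup S A E) : Matrix (Fin D.K) (Fin D.K) ℝ :=
  Matrix.of fun i j => ∫ e, D.ψ i e * D.ψ j e ∂D.noise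

/-- The vector `Σ_E⁻¹ ψ(ε)`. -/
def normψ (D : DualSetup S A E) (e : E) : Fin D.K → ℝ :=
  D.gramψ⁻¹.mulVec fun k => D.ψ k e

/-- The primal sample: the pairs `(X_i^h, ε_i^h)`, `0 ≤ h < H`, `1 ≤ i ≤ N`. -/
abbrev PrimalSample (D : DualSetup S A E) : Type _ := Fin D.H → Fin D.N → S × E

/-- The dual sample: the variables `ε_m^{t+1}`, `0 ≤ t < H`, `1 ≤ m ≤ M`. -/
abbrev DualSample (D : DualSetup S A E) : Type _ := Fin D.H → Fin D.M → E

/-- The law of the simulation: all variables are independent, `X_i^h ∼ μ_h`, and all noise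
variables have the law of the noise. -/
def simLaw (D : DualSetup S A E) : Measure (D.PrimalSample × D.DualSample) :=
  (Measure.pi fun h : Fin D.H => Measure.pi fun _ : Fin D.N => (D.μ h).prod D.noise).prod
    (Measure.pi fun _ : Fin D.H => Measure.pi fun _ : Fin D.M => D.noise)

/-- The approximate value functions `V_{h,N}` of the primal regression algorithm, as functions
of the primal sample `ω`: `V_{H,N} = F`, and for `h < H`
`V_{h,N}(x) = sup_a (R_h(x, a) + T[β_aᵀ γ(x)])`, where `T` truncates at the clipping level of
time `h + 1` and
`β_a = N⁻¹ ∑ i, V_{h+1,N}(𝒦_{h+1}(X_i^h, a, ε_i^h)) Σ_h⁻¹ γ(X_i^h)`. -/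
def VN (D : DualSetup S A E) (ω : D.PrimalSample) (h : ℕ) : S → ℝ :=
  if hh : h < D.H then
    fun x => ⨆ a : A, (D.R h x a +
      max (-D.clipLevel (h + 1)) (min (D.clipLevel (h + 1))
        (∑ k : Fin D.Kpr,
          ((D.N : ℝ)⁻¹ * ∑ i : Fin D.N,
            VN D ω (h + 1) (D.dyn (h + 1) ((ω ⟨h, hh⟩ i).1, a) (ω ⟨h, hh⟩ i).2) *
              D.normγ h (ω ⟨h, hh⟩ i).1 k) * D.γ k x)))
  else D.F
termination_by D.H - h

/-- The mean square error in the regression of `V_{t+1}^⋆(𝒦_{t+1}(x, a, ε))` on the `ψ_k`. -/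
def projObjective (D : DualSetup S A E) (t : ℕ) (p : S × A) (c : Fin D.K → ℝ) : ℝ :=
  ∫ e, (D.Vstar (t + 1) (D.dyn (t + 1) p e) - ∑ k, c k * D.ψ k e) ^ 2 ∂D.noise

/-- The coefficients `c_K(x, a)`: the minimizer of the mean square error. -/
def projCoeff (D : DualSetup S A E) (t : ℕ) (p : S × A) : Fin D.K → ℝ :=
  Classical.epsilon fun c => ∀ c', D.projObjective t p c ≤ D.projObjective t p c'

/-- The projection `η_{t+1,K}(x, a, ε)` of the optimal martingale function. -/
def eta (D : DualSetup S A E) (t : ℕ) (p : S × A) (e : E) : ℝ :=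
  ∑ k, D.projCoeff t p k * D.ψ k e

/-- The Monte Carlo coefficients
`c_{k,M}(x, a) = M⁻¹ ∑ m, V_{t+1,N}(𝒦_{t+1}(x, a, ε_m)) (Σ_E⁻¹ ψ(ε_m))_k`. -/
def mcCoeff (D : DualSetup S A E) (t : Fin D.H) (ω : D.PrimalSample × D.DualSample)
    (k : Fin D.K) (p : S × A) : ℝ :=
  (D.M : ℝ)⁻¹ * ∑ m : Fin D.M,
    D.VN ω.1 (t + 1) (D.dyn (t + 1) p (ω.2 t m)) * D.normψ (ω.2 t m) k

/-- `sup_{(x, a)} ‖dP_h(· | x, a)/dμ_h‖_∞`. -/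
def densitySup (D : DualSetup S A E) (h : ℕ) : ℝ≥0∞ :=
  ⨆ p : S × A, essSup ((D.transition h p).rnDeriv (D.μ h)) (D.μ h)

/-- `‖V_h^⋆ - V_{h,N}‖_{L²(μ_h ⊗ P)}`, `P` being the law of the simulation. -/
def primalError (D : DualSetup S A E) (h : ℕ) : ℝ≥0∞ :=
  eLpNorm (fun z : S × (D.PrimalSample × D.DualSample) => D.Vstar h z.1 - D.VN z.2.1 h z.1) 2
    ((D.μ h).prod D.simLaw)

end Algorithm

section Metric

variable {S A E : Type*} [MetricSpace S] [MetricSpace A]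
  [MeasurableSpace S] [MeasurableSpace A] [MeasurableSpace E]

/-- `ρ((x, a), (x', a')) = ‖(ρ_S(x, x'), ρ_A(a, a'))‖`. -/
def rho (D : DualSetup S A E) (p q : S × A) : ℝ := D.nrm (dist p.1 q.1, dist p.2 q.2)

/-- The diameter of `S × A` with respect to `ρ`. -/
def diam (D : DualSetup S A E) : ℝ≥0∞ := ⨆ (p : S × A) (q : S × A), ENNReal.ofReal (D.rho p q)

/-- The covering number of `S × A` with respect to `ρ` at radius `u`. -/
def coveringNumber (D : DualSetup S A E) (u : ℝ) : ℕ∞ :=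
  ⨅ (s : Finset (S × A)) (_ : ∀ p, ∃ q ∈ s, D.rho p q ≤ u), (s.card : ℕ∞)

/-- The Dudley integral `∫_0^diam √(log 𝒩(S × A, ρ, u)) du`. -/
def dudley (D : DualSetup S A E) : ℝ≥0∞ :=
  ∫⁻ u in {u : ℝ | 0 < u ∧ ENNReal.ofReal u ≤ D.diam},
    (if D.coveringNumber u = ⊤ then ⊤
      else ENNReal.ofReal (√(Real.log ((D.coveringNumber u).toNat : ℝ))))

/-- The points of the product of the two grids. -/
def grid (D : DualSetup S A E) (g : Fin D.L × Fin D.L) : S × A := (D.gridS g.1, D.gridA g.2)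

/-- The covering radius of the grid. -/
def coveringRadius (D : DualSetup S A E) : ℝ≥0∞ :=
  ⨆ p : S × A, ⨅ g : Fin D.L × Fin D.L, ENNReal.ofReal (D.rho p (D.grid g))

/-- The optimal central interpolant `I[f]` on the grid, for the Lipschitz constant `ℓ`. -/
def interp (D : DualSetup S A E) (ℓ : ℝ) (f : S × A → ℝ) (p : S × A) : ℝ :=
  ((⨆ g : Fin D.L × Fin D.L, (f (D.grid g) - ℓ * D.rho p (D.grid g))) +
    (⨅ g : Fin D.L × Fin D.L, (f (D.grid g) + ℓ * D.rho p (D.grid g)))) / 2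

/-- The estimate `∑ k, I[c_{k,M}](x, a) ψ_k(ε)` of the martingale function; the interpolation
uses the Lipschitz constant `L_V L_𝒦 Λ_ψ` of the coefficient functions `c_{k,M}`. -/
def etaTilde (D : DualSetup S A E) (t : Fin D.H) (ω : D.PrimalSample × D.DualSample)
    (p : S × A) (e : E) : ℝ :=
  ∑ k, D.interp (D.LV * D.LK * D.Λψ) (D.mcCoeff t ω k) p * D.ψ k e

end Metric

end DualSetup

end

/-!
The coefficients of the population regression are `c_k(p) = E[V⋆_{t+1}(𝒦(p, ε)) (Σ_E⁻¹ ψ(ε))_k]`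
for `p = (x, a)` (`DualSetup.projCoeff_eq`), so they have the same form as the Monte Carlo
coefficients, with the empirical mean replaced by the expectation and `V_{t+1,N}` by `V⋆_{t+1}`. By
the Cauchy-Schwarz inequality in `k` the error at `(p, ε)` is at most `|ψ(ε)|²` times
`∑ k, (c_k - I[c_{k,M}])(p)²`, and `ε` is independent of the sample. Each difference is a sum of
three terms, which give the three summands of the bound.

* `c_k(p) - E[V_{t+1,N}(𝒦(p, ε)) (Σ_E⁻¹ ψ(ε))_k | primal sample]` is controlled by Jensen's
  inequality and a change of measure from `P_{t+1}(· | p)` to `μ_{t+1}`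
  (`DualSetup.Assumptions.enorm_projCoeff_sub_integral_sq_le`).
* The deviation of `c_{k,M}(p)` from its conditional expectation given the primal sample is an
  empirical process with increments that are Lipschitz in `p`. Its supremum is bounded in `L²` by
  chaining (`eLpNorm_iSup_empiricalDeviation_le`). The input is Hoeffding's lemma and the maximal
  inequality `E max_i X_i² ≤ 4 c (1 + log n)` for `n` sub-Gaussian variables of variance proxy `c`
  (`lintegral_iSup_enorm_sq_le_of_hasSubgaussianMGF`). If the entropy integral or the diameter is
  infinite, the bound is infinite, unless the functions do not depend on `p` at all.
* `c_{k,M}` is Lipschitz with the constant of the interpolation, so the interpolation error is that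
  constant times the covering radius of the grid (`DualSetup.enorm_sub_interp_le`).

Two facts about the value functions make these steps legitimate. The optimal value function is
defined as a supremum over randomized Markov policies and is a priori not measurable; it is
identified with the solution of the Bellman recursion, which is Lipschitz
(`DualSetup.Assumptions.Vstar_eq_bellmanValue`), by patching together almost optimal actions over a
countable partition of the state space. The functions `V_{h,N}` are suprema over an uncountable
action space in which the reward is only measurable in the action; they are nevertheless jointly
measurable in the state and the sample, because the regression term is continuous in the action and
the graph of the reward is separable (`measurable_iSup_add_of_continuous`).
-/

noncomputable section

/-! ### Maximal inequality for sub-Gaussian families -/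

/-- Beyond the level `T` a square is dominated by an exponential, which turns bounds of moment
generating functions into bounds of second moments. -/
theorem sq_le_mul_one_add_exp {a T : ℝ} (ha : 2 ≤ a) (hT : 0 < T) (x : ℝ) :
    x ^ 2 ≤ T ^ 2 * (1 + Real.exp (a * (|x| / T - 1))) := by
  set y := |x| / T with hy
  have hx : x ^ 2 = T ^ 2 * y ^ 2 := by
    rw [hy, div_pow, sq_abs]; field_simp
  rw [hx]
  have hy0 : 0 ≤ y := by positivity
  refine mul_le_mul_of_nonneg_left ?_ (by positivity)
  rcases le_total y 1 with h1 | h1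
  · have := Real.exp_pos (a * (y - 1)); nlinarith
  · have h2 : y ≤ Real.exp (y - 1) := by linarith [Real.add_one_le_exp (y - 1)]
    have h3 : y ^ 2 ≤ Real.exp (2 * (y - 1)) := by
      rw [two_mul, Real.exp_add, sq]; exact mul_self_le_mul_self hy0 h2
    have h4 : Real.exp (2 * (y - 1)) ≤ Real.exp (a * (y - 1)) :=
      Real.exp_le_exp.2 (by nlinarith)
    linarith

/-- Maximal inequality: the largest of `n` sub-Gaussian variables of variance proxy `c`, which may
be dependent, has second moment at most `4 c (1 + log n)`. -/
theorem lintegral_iSup_enorm_sq_le_of_hasSubgaussianMGF {ι Ω : Type*} [MeasurableSpace Ω]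
    {μ : Measure Ω} [IsProbabilityMeasure μ] {X : ι → Ω → ℝ} {c : ℝ≥0} {s : Finset ι}
    (hs : s.Nonempty) (hX : ∀ i ∈ s, HasSubgaussianMGF (X i) c μ) :
    ∫⁻ ω, (⨆ i ∈ s, ‖X i ω‖ₑ) ^ 2 ∂μ ≤ ENNReal.ofReal (4 * c * (1 + Real.log s.card)) := by
  rcases eq_or_ne c 0 with rfl | hc
  · have h0 : ∀ᵐ ω ∂μ, ∀ i ∈ s, X i ω = 0 := by
      exact (Finset.eventually_all s).2 fun i hi => (hX i hi).ae_eq_zero_of_hasSubgaussianMGF_zero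
    rw [lintegral_congr_ae (g := fun _ => 0)]
    · simp
    · filter_upwards [h0] with ω hω
      simp +contextual [hω]
  have hc' : (0 : ℝ) < c := by positivity
  have hn : (1 : ℝ) ≤ s.card := by exact_mod_cast hs.card_pos
  have hlog : 0 ≤ Real.log s.card := Real.log_nonneg hn
  -- With `T² = c a`, the bound `exp (c (a / T)² / 2 - a)` of each exponential moment becomes
  -- `exp (-a / 2)`, and this choice of `a` makes it small enough to be summed over `s`.
  set a : ℝ := 2 * (1 + Real.log s.card) with ha
  set T : ℝ := √(c * a) with hT
  have ha2 : 2 ≤ a := by linarith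
  have hT0 : 0 < T := Real.sqrt_pos.2 (by positivity)
  have hTsq : T ^ 2 = c * a := Real.sq_sqrt (by positivity)
  let Y : ι → Ω → ℝ := fun i ω =>
    Real.exp (-a) * (Real.exp (a / T * X i ω) + Real.exp (-(a / T) * X i ω))
  have hYint : ∀ i ∈ s, Integrable (Y i) μ := fun i hi =>
    (((hX i hi).integrable_exp_mul _).add ((hX i hi).integrable_exp_mul _)).const_mul _
  have hYle : ∀ i ∈ s, ∫ ω, Y i ω ∂μ ≤ 2 * Real.exp (-(1 + Real.log s.card)) := by
    intro i hi
    have h1 := (hX i hi).mgf_le (a / T)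
    have h2 := (hX i hi).mgf_le (-(a / T))
    rw [mgf] at h1 h2
    have hex : (c : ℝ) * (a / T) ^ 2 / 2 = 1 + Real.log s.card := by
      rw [div_pow, hTsq]; field_simp; rw [ha]
    rw [neg_sq, hex] at h2
    rw [hex] at h1
    have h3 : Real.exp (-a) * Real.exp (1 + Real.log s.card)
        = Real.exp (-(1 + Real.log s.card)) := by
      rw [← Real.exp_add]; congr 1; rw [ha]; ring
    simp only [Y]
    rw [integral_const_mul, integral_add ((hX i hi).integrable_exp_mul _)
      ((hX i hi).integrable_exp_mul _), ← h3]
    have := Real.exp_pos (-a)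
    nlinarith
  have hYpos : ∀ i ω, 0 ≤ Y i ω := fun i ω => by positivity
  have hpt : ∀ ω, (⨆ i ∈ s, ‖X i ω‖ₑ) ^ 2 ≤
      ENNReal.ofReal (T ^ 2 * (1 + ∑ i ∈ s, Y i ω)) := by
    intro ω
    obtain ⟨i, hi, hmax⟩ := s.exists_max_image (fun i => ‖X i ω‖ₑ) hs
    have hsup : (⨆ i ∈ s, ‖X i ω‖ₑ) = ‖X i ω‖ₑ :=
      le_antisymm (iSup₂_le hmax) (le_iSup₂ (f := fun i _ => ‖X i ω‖ₑ) i hi)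
    rw [hsup, Real.enorm_eq_ofReal_abs, ← ENNReal.ofReal_pow (abs_nonneg _), sq_abs]
    refine ENNReal.ofReal_le_ofReal ((sq_le_mul_one_add_exp ha2 hT0 _).trans ?_)
    have h1 : Real.exp (a * (|X i ω| / T - 1)) ≤ Y i ω := by
      have h2 : Real.exp (a * (|X i ω| / T - 1))
          = Real.exp (-a) * Real.exp (a / T * |X i ω|) := by
        rw [← Real.exp_add]; congr 1; ring
      rw [h2]
      refine mul_le_mul_of_nonneg_left ?_ (Real.exp_pos _).le
      rcases abs_cases (X i ω) with ⟨h, _⟩ | ⟨h, _⟩ <;> rw [h]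
      · linarith [Real.exp_pos (-(a / T) * X i ω)]
      · rw [mul_neg, ← neg_mul]; linarith [Real.exp_pos (a / T * X i ω)]
    have h2 : Y i ω ≤ ∑ i ∈ s, Y i ω := Finset.single_le_sum (fun j _ => hYpos j ω) hi
    gcongr
    exact h1.trans h2
  refine (lintegral_mono hpt).trans ?_
  have hint : Integrable (fun ω => ∑ i ∈ s, Y i ω) μ := integrable_finsetSum s hYint
  rw [← ofReal_integral_eq_lintegral_ofReal (f := fun ω => T ^ 2 * (1 + ∑ i ∈ s, Y i ω))
    (((integrable_const (1 : ℝ)).add hint).const_mul _)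
    (Filter.Eventually.of_forall fun ω =>
      mul_nonneg (sq_nonneg _) (add_nonneg zero_le_one (Finset.sum_nonneg fun i _ => hYpos i ω)))]
  refine ENNReal.ofReal_le_ofReal ?_
  rw [integral_const_mul, integral_add (integrable_const _) hint, integral_finsetSum s hYint]
  have h5 : ∑ i ∈ s, ∫ ω, Y i ω ∂μ ≤ 1 := by
    refine (Finset.sum_le_card_nsmul s _ _ hYle).trans ?_
    rw [nsmul_eq_mul, neg_add, Real.exp_add, Real.exp_neg (Real.log _),
      Real.exp_log (by linarith)]
    have h6 : Real.exp (-1) ≤ 1 / 2 := by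
      rw [Real.exp_neg]
      have := Real.add_one_le_exp (1 : ℝ)
      rw [inv_le_comm₀ (Real.exp_pos _) (by norm_num)]; linarith
    field_simp
    linarith
  simp only [integral_const, probReal_univ, smul_eq_mul, mul_one]
  rw [hTsq, ha]
  have h7 : 0 ≤ (c : ℝ) * (2 * (1 + Real.log s.card)) := by positivity
  nlinarith

/-- The maximal inequality for the `L²` norm, with the contributions of the scale and of the
cardinality separated. -/
theorem eLpNorm_iSup_enorm_le_of_hasSubgaussianMGF {ι Ω : Type*} [MeasurableSpace Ω]
    {μ : Measure Ω} [IsProbabilityMeasure μ] {X : ι → Ω → ℝ} {c : ℝ≥0} {s : Finset ι}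
    (hs : s.Nonempty) (hX : ∀ i ∈ s, HasSubgaussianMGF (X i) (c ^ 2) μ) :
    eLpNorm (fun ω => ⨆ i ∈ s, ‖X i ω‖ₑ) 2 μ ≤
      2 * c * (1 + ENNReal.ofReal (√(Real.log s.card))) := by
  have h := lintegral_iSup_enorm_sq_le_of_hasSubgaussianMGF hs hX
  have hn : (1 : ℝ) ≤ s.card := by exact_mod_cast hs.card_pos
  have hlog : 0 ≤ Real.log s.card := Real.log_nonneg hn
  have h2 := eLpNorm_nnreal_pow_eq_lintegral (μ := μ) (f := fun ω => ⨆ i ∈ s, ‖X i ω‖ₑ)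
    (p := 2) (by norm_num)
  simp only [enorm_eq_self, NNReal.coe_ofNat, ENNReal.rpow_ofNat, ENNReal.coe_ofNat] at h2
  rw [← h2] at h
  refine (ENNReal.pow_le_pow_left_iff two_ne_zero).1 (h.trans ?_)
  have h3 : (2 : ℝ≥0∞) * c * (1 + ENNReal.ofReal (√(Real.log s.card)))
      = ENNReal.ofReal (2 * c * (1 + √(Real.log s.card))) := by
    rw [ENNReal.ofReal_mul (by positivity), ENNReal.ofReal_mul (by positivity),
      ENNReal.ofReal_add zero_le_one (by positivity)]
    simp
  rw [h3, ← ENNReal.ofReal_pow (by positivity)]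
  refine ENNReal.ofReal_le_ofReal ?_
  push_cast
  have h4 := Real.sq_sqrt hlog
  have h5 := Real.sqrt_nonneg (Real.log s.card)
  have : 4 * (c : ℝ) ^ 2 * (1 + Real.log s.card) ≤
      4 * (c : ℝ) ^ 2 * (1 + √(Real.log s.card)) ^ 2 := by
    refine mul_le_mul_of_nonneg_left ?_ (by positivity)
    nlinarith
  nlinarith

/-- The deviation `M⁻¹ ∑ m, g (ω m) - ∫ g dP` of an empirical mean from its expectation. -/
def empiricalDeviation {E : Type*} [MeasurableSpace E] (P : Measure E) (M : ℕ) (g : E → ℝ)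
    (ω : Fin M → E) : ℝ :=
  (M : ℝ)⁻¹ * ∑ m, g (ω m) - ∫ e, g e ∂P

/-- Hoeffding's inequality for an empirical mean of `M` independent draws. -/
theorem hasSubgaussianMGF_empiricalDeviation {E : Type*} [MeasurableSpace E] {P : Measure E}
    [IsProbabilityMeasure P] {M : ℕ} (hM : 0 < M) {g : E → ℝ} (hg : Measurable g) {b : ℝ≥0}
    (hb : ∀ e, |g e| ≤ b) :
    HasSubgaussianMGF (empiricalDeviation P M g) ((b / NNReal.sqrt M) ^ 2)
      (Measure.pi fun _ => P) := by
  have hM' : (M : ℝ) ≠ 0 := by positivity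
  have h1 : HasSubgaussianMGF (fun e => g e - ∫ e, g e ∂P) (b ^ 2) P := by
    have := hasSubgaussianMGF_of_mem_Icc (μ := P) (X := g) (a := -b) (b := b) hg.aemeasurable
      (Filter.Eventually.of_forall fun e => abs_le.1 (hb e))
    convert this using 2
    ext
    simp
    rw [abs_of_nonneg (by positivity)]; ring
  have h2 : ∀ m ∈ (Finset.univ : Finset (Fin M)), HasSubgaussianMGF
      (fun ω : Fin M → E => g (ω m) - ∫ e, g e ∂P) (b ^ 2) (Measure.pi fun _ => P) := by
    intro m _
    refine HasSubgaussianMGF.of_map (X := fun e => g e - ∫ e, g e ∂P)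
      (Y := fun ω : Fin M → E => ω m) (measurable_pi_apply m).aemeasurable ?_
    have := (measurePreserving_eval (fun _ : Fin M => P) m).map_eq
    rw [show (fun ω : Fin M → E => ω m) = Function.eval m from rfl, this]
    exact h1
  have h3 := (HasSubgaussianMGF.sum_of_iIndepFun
    (iIndepFun_pi (X := fun (_ : Fin M) e => g e - ∫ e, g e ∂P) (μ := fun _ => P)
      (fun _ => (hg.sub_const _).aemeasurable)) h2).const_mul (M : ℝ)⁻¹
  have hc : (b / NNReal.sqrt M) ^ 2 =
      (M : ℝ≥0)⁻¹ ^ 2 * ∑ _m : Fin M, b ^ 2 := by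
    have hM'' : (M : ℝ≥0) ≠ 0 := by positivity
    rw [div_pow, NNReal.sq_sqrt]
    simp only [Finset.sum_const, Finset.card_univ, Fintype.card_fin, nsmul_eq_mul]
    field_simp
  convert h3 using 1
  · ext ω
    rw [Finset.sum_sub_distrib, empiricalDeviation]
    simp
    field_simp
  · exact hc

theorem Measurable.empiricalDeviation {E : Type*} [MeasurableSpace E] {P : Measure E} {M : ℕ}
    {g : E → ℝ} (hg : Measurable g) : Measurable (empiricalDeviation P M g) := by
  unfold _root_.empiricalDeviation
  fun_prop

theorem integrable_of_abs_le {E : Type*} [MeasurableSpace E] {P : Measure E} [IsFiniteMeasure P]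
    {g : E → ℝ} (hg : Measurable g) {b : ℝ} (hb : ∀ e, |g e| ≤ b) : Integrable g P :=
  Integrable.of_bound hg.aestronglyMeasurable b (Filter.Eventually.of_forall hb)

theorem abs_integral_le_of_abs_le {Ω : Type*} [MeasurableSpace Ω] {P : Measure Ω}
    [IsProbabilityMeasure P] {f : Ω → ℝ} {c : ℝ} (h : ∀ x, |f x| ≤ c) : |∫ x, f x ∂P| ≤ c := by
  have := norm_integral_le_of_norm_le_const (μ := P) (f := f)
    (Filter.Eventually.of_forall fun e => (Real.norm_eq_abs _).trans_le (h e))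
  simpa using this

theorem empiricalDeviation_sub {E : Type*} [MeasurableSpace E] {P : Measure E} {M : ℕ}
    {f g : E → ℝ} (hf : Integrable f P) (hg : Integrable g P) (ω : Fin M → E) :
    empiricalDeviation P M (fun e => f e - g e) ω =
      empiricalDeviation P M f ω - empiricalDeviation P M g ω := by
  simp only [empiricalDeviation, Finset.sum_sub_distrib, integral_sub hf hg]
  ring

theorem abs_empiricalDeviation_le {E : Type*} [MeasurableSpace E] {P : Measure E}
    [IsProbabilityMeasure P] {M : ℕ} (hM : 0 < M) {g : E → ℝ} {b : ℝ} (hb : ∀ e, |g e| ≤ b)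
    (ω : Fin M → E) : |empiricalDeviation P M g ω| ≤ 2 * b := by
  have hM' : (0 : ℝ) < M := by positivity
  have h1 : |(M : ℝ)⁻¹ * ∑ m, g (ω m)| ≤ b := by
    rw [abs_mul, abs_inv, abs_of_pos hM', inv_mul_le_iff₀ hM']
    refine (Finset.abs_sum_le_sum_abs _ _).trans ?_
    refine (Finset.sum_le_card_nsmul _ _ b fun m _ => hb _).trans ?_
    simp
  have h2 : |∫ e, g e ∂P| ≤ b := abs_integral_le_of_abs_le hb
  unfold empiricalDeviation
  exact (abs_sub _ _).trans (by linarith)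

/-! ### Chaining -/

/-- Comparison of a dyadic sum with an integral: `d / 2 ^ j` is four times the length of the
interval from `d / 2 ^ (j + 2)` to `d / 2 ^ (j + 1)`, on which `φ` is at least
`φ (d / 2 ^ (j + 1))`. -/
theorem sum_mul_le_lintegral_of_antitoneOn {φ : ℝ → ℝ≥0∞} {d : ℝ≥0}
    (hφ : AntitoneOn φ (Set.Ioc 0 (d : ℝ))) (n : ℕ) :
    ∑ j ∈ Finset.range n, ((d / 2 ^ j : ℝ≥0) : ℝ≥0∞) * φ ((d / 2 ^ (j + 1) : ℝ≥0) : ℝ) ≤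
      4 * ∫⁻ u in Set.Ioc 0 (d : ℝ), φ u := by
  rcases eq_or_ne d 0 with rfl | hd
  · simp
  have hd0 : (0 : ℝ) < d := by positivity
  have hmono : ∀ j : ℕ, (d : ℝ) / 2 ^ (j + 1) ≤ d / 2 ^ j := fun j => by
    gcongr <;> norm_num
  have key : ∀ n : ℕ, ∑ j ∈ Finset.range n,
      ((d / 2 ^ j : ℝ≥0) : ℝ≥0∞) * φ ((d / 2 ^ (j + 1) : ℝ≥0) : ℝ) ≤
      4 * ∫⁻ u in Set.Ioc ((d : ℝ) / 2 ^ (n + 1)) (d / 2), φ u := by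
    intro n
    induction n with
    | zero => simp
    | succ n ih =>
      have hle : (d : ℝ) / 2 ^ (n + 1) ≤ d / 2 := by
        gcongr
        exact le_self_pow₀ (by norm_num) (by omega)
      rw [Finset.sum_range_succ, ← Set.Ioc_union_Ioc_eq_Ioc (hmono (n + 1)) hle,
        lintegral_union measurableSet_Ioc, mul_add, add_comm]
      · refine add_le_add ?_ ih
        have h1 : ∫⁻ _ in Set.Ioc ((d : ℝ) / 2 ^ (n + 1 + 1)) (d / 2 ^ (n + 1)),
            φ ((d / 2 ^ (n + 1) : ℝ≥0) : ℝ) ≤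
            ∫⁻ u in Set.Ioc ((d : ℝ) / 2 ^ (n + 1 + 1)) (d / 2 ^ (n + 1)), φ u := by
          refine setLIntegral_mono' measurableSet_Ioc fun u hu => ?_
          have h2 : (d : ℝ) / 2 ^ (n + 1) ≤ d := div_le_self hd0.le (one_le_pow₀ (by norm_num))
          refine hφ ⟨lt_trans (by positivity) hu.1, hu.2.trans h2⟩ ⟨by positivity, ?_⟩ ?_
          · simpa using h2
          · simpa using hu.2
        refine le_trans (le_of_eq ?_) (mul_le_mul_right h1 4)
        rw [setLIntegral_const, Real.volume_Ioc, mul_comm _ (ENNReal.ofReal _), ← mul_assoc]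
        congr 1
        rw [show (4 : ℝ≥0∞) = ENNReal.ofReal 4 by simp, ← ENNReal.ofReal_mul (by norm_num),
          ← ENNReal.ofReal_coe_nnreal]
        congr 1
        push_cast
        rw [pow_succ, pow_succ]
        field_simp
        ring
      · rw [Set.disjoint_left]
        intro u hu hu'
        exact absurd hu.2 (not_le.2 hu'.1)
  refine (key n).trans (mul_le_mul_right (lintegral_mono_set (Set.Ioc_subset_Ioc ?_ ?_)) 4)
  · positivity
  · linarith

theorem sum_geometric_le (d : ℝ≥0) (n : ℕ) :
    ∑ j ∈ Finset.range n, ((d / 2 ^ j : ℝ≥0) : ℝ≥0∞) ≤ 2 * d := by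
  have h : ∑ j ∈ Finset.range n, d / 2 ^ j + 2 * (d / 2 ^ n) = 2 * d := by
    induction n with
    | zero => simp
    | succ n ih =>
      rw [Finset.sum_range_succ, ← ih, add_assoc]
      congr 1
      rw [pow_succ]
      field_simp
      norm_num
  exact_mod_cast (le_self_add.trans h.le : ∑ j ∈ Finset.range n, d / 2 ^ j ≤ 2 * d)

/-- Dudley's entropy bound for the empirical process of a Lipschitz family of bounded functions.
The function `φ` bounds the root of the metric entropy. No separability is needed: the process is
Lipschitz for each sample, so the links of a finite chain leave a remainder that vanishes
uniformly. -/
theorem eLpNorm_iSup_empiricalDeviation_le {T E : Type*} [Nonempty T] [MeasurableSpace E]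
    {P : Measure E} [IsProbabilityMeasure P] {M : ℕ} (hM : 0 < M) {g : T → E → ℝ}
    (hg : ∀ p, Measurable (g p)) {ρ : T → T → ℝ} {ℓ b d : ℝ≥0} (hb : ∀ p e, |g p e| ≤ b)
    (hlip : ∀ p q e, |g p e - g q e| ≤ ℓ * ρ p q) (hd : 0 < d) (hρd : ∀ p q, ρ p q ≤ d)
    {φ : ℝ → ℝ≥0∞} (hφ : AntitoneOn φ (Set.Ioc 0 (d : ℝ)))
    (hnet : ∀ u : ℝ, 0 < u → u ≤ d → ∃ s : Finset T, (∀ p, ∃ q ∈ s, ρ p q ≤ u) ∧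
      ENNReal.ofReal (√(Real.log s.card)) ≤ φ u) :
    eLpNorm (fun ω => ⨆ p, ‖empiricalDeviation P M (g p) ω‖ₑ) 2 (Measure.pi fun _ => P) ≤
      8 * (ℓ * (∫⁻ u in Set.Ioc 0 (d : ℝ), φ u) + ℓ * d + b) / NNReal.sqrt M := by
  obtain ⟨p₀⟩ := ‹Nonempty T›
  have hint : ∀ p, Integrable (g p) P := fun p => integrable_of_abs_le (hg p) (hb p)
  set Z : T → (Fin M → E) → ℝ := fun p => empiricalDeviation P M (g p) with hZ
  have hZm : ∀ p, Measurable (Z p) := fun p => (hg p).empiricalDeviation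
  set ν : Measure (Fin M → E) := Measure.pi fun _ => P
  set r : ℝ≥0 := NNReal.sqrt M with hr
  let u : ℕ → ℝ≥0 := fun j => d / 2 ^ j
  -- A single point is a net at the scale `d`, so the chains start without entropy.
  have hnets : ∀ j : ℕ, ∃ s : Finset T, (∀ p, ∃ q ∈ s, ρ p q ≤ u j) ∧
      ENNReal.ofReal (√(Real.log s.card)) ≤ if j = 0 then 0 else φ (u j) := by
    intro j
    rcases eq_or_ne j 0 with rfl | hj
    · exact ⟨{p₀}, fun p => ⟨p₀, by simp, by simpa [u] using hρd p p₀⟩, by simp⟩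
    · obtain ⟨s, hs, hs'⟩ := hnet (u j) (by positivity) (by
        simp only [u]; push_cast
        exact div_le_self d.2 (one_le_pow₀ (by norm_num)))
      exact ⟨s, hs, by simpa [hj] using hs'⟩
  choose s hs hcard using hnets
  choose π hπs hπ using hs
  have hsne : ∀ j, (s j).Nonempty := fun j => ⟨π j p₀, hπs j p₀⟩
  have hincr : ∀ p q, ∀ v : ℝ≥0, ρ p q ≤ v → ∀ e, |g p e - g q e| ≤ (ℓ * v : ℝ≥0) :=
    fun p q v h e => (hlip p q e).trans (by push_cast; gcongr)
  have hZsub : ∀ p q ω, empiricalDeviation P M (fun e => g p e - g q e) ω = Z p ω - Z q ω :=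
    fun p q ω => empiricalDeviation_sub (hint p) (hint q) ω
  -- `G j` is the supremum over the `j`-th net, `I j` the largest link from the net `j + 1` to the
  -- net `j`. Each point of the finer net has one link, so the number of links is its cardinality.
  let G : ℕ → (Fin M → E) → ℝ≥0∞ := fun j ω => ⨆ p ∈ s j, ‖Z p ω‖ₑ
  let I : ℕ → (Fin M → E) → ℝ≥0∞ := fun j ω =>
    ⨆ p ∈ s (j + 1), ‖empiricalDeviation P M (fun e => g p e - g (π j p) e) ω‖ₑ
  have hGm : ∀ j, Measurable (G j) := fun j =>
    Measurable.biSup _ (s j).countable_toSet fun p _ => (hZm p).enorm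
  have hIm : ∀ j, Measurable (I j) := fun j =>
    Measurable.biSup _ (s (j + 1)).countable_toSet
      fun p _ => ((hg p).sub (hg (π j p))).empiricalDeviation.enorm
  have hI : ∀ j, eLpNorm (I j) 2 ν ≤ 2 * ((ℓ * u j / r : ℝ≥0) : ℝ≥0∞) * (1 + φ (u (j + 1))) := by
    intro j
    refine (eLpNorm_iSup_enorm_le_of_hasSubgaussianMGF (hsne (j + 1)) fun p _ =>
      hasSubgaussianMGF_empiricalDeviation hM ((hg p).sub (hg (π j p)))
        (hincr p (π j p) (u j) (hπ j p))).trans ?_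
    gcongr
    simpa using hcard (j + 1)
  have hstep : ∀ j ω, G (j + 1) ω ≤ G j ω + I j ω := by
    intro j ω
    refine iSup₂_le fun p hp => ?_
    have h1 : Z p ω = Z (π j p) ω + empiricalDeviation P M (fun e => g p e - g (π j p) e) ω := by
      rw [hZsub]; ring
    rw [h1]
    refine (enorm_add_le _ _).trans (add_le_add ?_ ?_)
    · exact le_iSup₂ (f := fun p (_ : p ∈ s j) => ‖Z p ω‖ₑ) (π j p) (hπs j p)
    · exact le_iSup₂ (f := fun p (_ : p ∈ s (j + 1)) =>
        ‖empiricalDeviation P M (fun e => g p e - g (π j p) e) ω‖ₑ) p hp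
  have hG : ∀ n, eLpNorm (G n) 2 ν ≤ 2 * ((b / r : ℝ≥0) : ℝ≥0∞) +
      ∑ j ∈ Finset.range n, 2 * ((ℓ * u j / r : ℝ≥0) : ℝ≥0∞) * (1 + φ (u (j + 1))) := by
    intro n
    induction n with
    | zero =>
      refine (eLpNorm_iSup_enorm_le_of_hasSubgaussianMGF (hsne 0) fun p _ =>
        hasSubgaussianMGF_empiricalDeviation hM (hg p) (hb p)).trans ?_
      have h0 := hcard 0
      simp only [if_true, nonpos_iff_eq_zero] at h0
      rw [h0]
      simp [hr]
    | succ n ih =>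
      rw [Finset.sum_range_succ, ← add_assoc]
      calc eLpNorm (G (n + 1)) 2 ν ≤ eLpNorm (G n + I n) 2 ν :=
            eLpNorm_mono_enorm fun ω => by simpa using hstep n ω
        _ ≤ eLpNorm (G n) 2 ν + eLpNorm (I n) 2 ν :=
            eLpNorm_add_le (hGm n).aestronglyMeasurable (hIm n).aestronglyMeasurable (by norm_num)
        _ ≤ _ := add_le_add ih (hI n)
  have hsum : ∀ n, ∑ j ∈ Finset.range n, 2 * ((ℓ * u j / r : ℝ≥0) : ℝ≥0∞) * (1 + φ (u (j + 1))) ≤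
      2 * ((ℓ / r : ℝ≥0) : ℝ≥0∞) * (2 * d + 4 * ∫⁻ u in Set.Ioc 0 (d : ℝ), φ u) := by
    intro n
    refine le_trans (le_of_eq ?_) (mul_le_mul_right
      (add_le_add (sum_geometric_le d n) (sum_mul_le_lintegral_of_antitoneOn hφ n)) _)
    rw [← Finset.sum_add_distrib, Finset.mul_sum]
    refine Finset.sum_congr rfl fun j _ => ?_
    rw [show ℓ * u j / r = ℓ / r * (d / 2 ^ j) by simp only [u]; ring, ENNReal.coe_mul]
    simp only [u]
    ring
  have hsup : ∀ n ω, ⨆ p, ‖Z p ω‖ₑ ≤ G n ω + ((2 * (ℓ * u n) : ℝ≥0) : ℝ≥0∞) := by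
    intro n ω
    refine iSup_le fun p => ?_
    have h1 : Z p ω = Z (π n p) ω + empiricalDeviation P M (fun e => g p e - g (π n p) e) ω := by
      rw [hZsub]; ring
    rw [h1]
    refine (enorm_add_le _ _).trans (add_le_add ?_ ?_)
    · exact le_iSup₂ (f := fun p (_ : p ∈ s n) => ‖Z p ω‖ₑ) (π n p) (hπs n p)
    · have := abs_empiricalDeviation_le (P := P) hM (hincr p (π n p) (u n) (hπ n p)) ω
      rw [enorm_le_coe]
      exact_mod_cast this
  have hfin : ∀ n, eLpNorm (fun ω => ⨆ p, ‖Z p ω‖ₑ) 2 ν ≤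
      (2 * ((b / r : ℝ≥0) : ℝ≥0∞) +
        2 * ((ℓ / r : ℝ≥0) : ℝ≥0∞) * (2 * d + 4 * ∫⁻ u in Set.Ioc 0 (d : ℝ), φ u)) +
      ((2 * (ℓ * u n) : ℝ≥0) : ℝ≥0∞) := by
    intro n
    calc eLpNorm (fun ω => ⨆ p, ‖Z p ω‖ₑ) 2 ν
        ≤ eLpNorm (G n + fun _ => ((2 * (ℓ * u n) : ℝ≥0) : ℝ≥0∞)) 2 ν :=
          eLpNorm_mono_enorm fun ω => by simpa using hsup n ω
      _ ≤ eLpNorm (G n) 2 ν + eLpNorm (fun _ => ((2 * (ℓ * u n) : ℝ≥0) : ℝ≥0∞)) 2 ν :=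
          eLpNorm_add_le (hGm n).aestronglyMeasurable aestronglyMeasurable_const (by norm_num)
      _ ≤ _ := by
          refine add_le_add ((hG n).trans (add_le_add le_rfl (hsum n))) ?_
          rw [eLpNorm_const _ (by norm_num) (IsProbabilityMeasure.ne_zero ν)]
          simp
  have hu : Filter.Tendsto (fun n => ((2 * (ℓ * u n) : ℝ≥0) : ℝ≥0∞)) Filter.atTop (nhds 0) := by
    have h1 : Filter.Tendsto (fun n : ℕ => 2 * (ℓ * u n)) Filter.atTop (nhds (2 * (ℓ * 0))) := by
      refine Filter.Tendsto.const_mul _ (Filter.Tendsto.const_mul _ ?_)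
      have h2 : Filter.Tendsto (fun n : ℕ => d * (1 / 2 : ℝ≥0) ^ n) Filter.atTop
          (nhds (d * 0)) := (NNReal.tendsto_pow_atTop_nhds_zero_of_lt_one
            (by rw [← NNReal.coe_lt_coe]; norm_num)).const_mul d
      rw [mul_zero] at h2
      refine h2.congr fun n => ?_
      simp only [u]
      rw [one_div, inv_pow, div_eq_mul_inv]
    rw [mul_zero, mul_zero] at h1
    exact ENNReal.tendsto_coe.2 h1
  have hlim := ge_of_tendsto' (hu.const_add (2 * ((b / r : ℝ≥0) : ℝ≥0∞) +
        2 * ((ℓ / r : ℝ≥0) : ℝ≥0∞) * (2 * d + 4 * ∫⁻ u in Set.Ioc 0 (d : ℝ), φ u))) hfin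
  refine hlim.trans ?_
  have hr0 : r ≠ 0 := by
    rw [hr, Ne, NNReal.sqrt_eq_zero]; exact_mod_cast hM.ne'
  rw [add_zero, ENNReal.coe_div hr0, ENNReal.coe_div hr0, div_eq_mul_inv, div_eq_mul_inv,
    div_eq_mul_inv]
  set J := ∫⁻ u in Set.Ioc 0 (d : ℝ), φ u
  calc 2 * ((b : ℝ≥0∞) * (r : ℝ≥0∞)⁻¹) + 2 * (ℓ * (r : ℝ≥0∞)⁻¹) * (2 * d + 4 * J)
      = (8 * (ℓ * J) + 4 * (ℓ * d) + 2 * b) * (r : ℝ≥0∞)⁻¹ := by ring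
    _ ≤ (8 * (ℓ * J) + 8 * (ℓ * d) + 8 * b) * (r : ℝ≥0∞)⁻¹ := by
        gcongr <;> norm_num
    _ = _ := by ring

namespace DualSetup

/-! ### The metric on state-action pairs, its entropy and interpolation -/

section Metric

variable {S A E : Type*} [MetricSpace S] [MetricSpace A]
  [MeasurableSpace S] [MeasurableSpace E]

theorem rho_nonneg (D : DualSetup S A E) (p q : S × A) : 0 ≤ D.rho p q := apply_nonneg _ _

theorem rho_le (D : DualSetup S A E) (p q : S × A) :
    D.rho p q ≤ dist p.1 q.1 * D.nrm (1, 0) + dist p.2 q.2 * D.nrm (0, 1) := by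
  have h : (dist p.1 q.1, dist p.2 q.2) =
      dist p.1 q.1 • ((1 : ℝ), (0 : ℝ)) + dist p.2 q.2 • ((0 : ℝ), (1 : ℝ)) := by simp
  rw [rho, h]
  refine (map_add_le_add _ _ _).trans (le_of_eq ?_)
  rw [map_smul_eq_mul, map_smul_eq_mul, Real.norm_of_nonneg dist_nonneg,
    Real.norm_of_nonneg dist_nonneg]

/-- Functions that are Lipschitz for `ρ` are continuous for the product topology. -/
theorem continuous_of_abs_sub_le_rho (D : DualSetup S A E) {f : S × A → ℝ} {ℓ : ℝ≥0}
    (hf : ∀ p q, |f p - f q| ≤ ℓ * D.rho p q) : Continuous f := by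
  have hL : LipschitzWith (ℓ * ((D.nrm (1, 0)).toNNReal + (D.nrm (0, 1)).toNNReal)) f := by
    refine LipschitzWith.of_dist_le_mul fun p q => ?_
    rw [Real.dist_eq]
    refine (hf p q).trans ?_
    push_cast
    rw [Real.coe_toNNReal _ (apply_nonneg _ _), Real.coe_toNNReal _ (apply_nonneg _ _), mul_assoc]
    refine mul_le_mul_of_nonneg_left ((D.rho_le p q).trans ?_) ℓ.coe_nonneg
    rw [add_mul]
    have h1 : dist p.1 q.1 ≤ dist p q := le_max_left _ _
    have h2 : dist p.2 q.2 ≤ dist p q := le_max_right _ _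
    have h3 : 0 ≤ D.nrm (1, 0) := apply_nonneg _ _
    have h4 : 0 ≤ D.nrm (0, 1) := apply_nonneg _ _
    nlinarith
  exact hL.continuous

theorem coveringNumber_anti (D : DualSetup S A E) {u v : ℝ} (huv : u ≤ v) :
    D.coveringNumber v ≤ D.coveringNumber u :=
  le_iInf₂ fun s hs => iInf₂_le s fun p => (hs p).imp fun _ h => ⟨h.1, h.2.trans huv⟩

/-- The integrand of the Dudley integral. -/
def entropyRoot (D : DualSetup S A E) (u : ℝ) : ℝ≥0∞ :=
  if D.coveringNumber u = ⊤ then ⊤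
    else ENNReal.ofReal (√(Real.log ((D.coveringNumber u).toNat : ℝ)))

/-- The infimum that defines a finite covering number is attained. -/
theorem exists_net (D : DualSetup S A E) {u : ℝ} (hu : D.coveringNumber u ≠ ⊤) :
    ∃ s : Finset (S × A), (∀ p, ∃ q ∈ s, D.rho p q ≤ u) ∧
      s.card ≤ (D.coveringNumber u).toNat := by
  have h1 : D.coveringNumber u < D.coveringNumber u + 1 := ENat.lt_add_one_iff hu |>.2 le_rfl
  nth_rewrite 1 [coveringNumber] at h1
  simp only [iInf_lt_iff] at h1
  obtain ⟨s, hs, hc⟩ := h1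
  refine ⟨s, hs, ?_⟩
  have h2 := (ENat.lt_add_one_iff hu).1 hc
  rw [← ENat.natCast_toNat hu] at h2
  exact_mod_cast h2

theorem entropyRoot_anti [Nonempty (S × A)] (D : DualSetup S A E) : Antitone D.entropyRoot := by
  intro u v huv
  unfold entropyRoot
  have h1 := D.coveringNumber_anti huv
  by_cases hu : D.coveringNumber u = ⊤
  · simp [hu]
  have hv : D.coveringNumber v ≠ ⊤ := ne_top_of_le_ne_top hu h1
  simp only [hu, hv, if_false]
  refine ENNReal.ofReal_le_ofReal (Real.sqrt_le_sqrt ?_)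
  obtain ⟨s, hs, hc⟩ := D.exists_net hv
  have hpos : 0 < (D.coveringNumber v).toNat := by
    obtain ⟨p⟩ := ‹Nonempty (S × A)›
    obtain ⟨q, hq, -⟩ := hs p
    have h0 : D.coveringNumber v ≠ 0 := by
      intro h0
      rw [h0] at hc
      simp at hc
      simp [hc] at hq
    rw [Nat.pos_iff_ne_zero, Ne, ENat.toNat_eq_zero]
    simp [h0, hv]
  refine Real.log_le_log (by exact_mod_cast hpos) ?_
  exact_mod_cast ENat.toNat_le_toNat h1 hu

/-- The entropy bound for the metric `ρ` on the state-action pairs, with values in `[0, ∞]`. -/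
theorem lintegral_iSup_empiricalDeviation_sq_le [Nonempty (S × A)] (D : DualSetup S A E)
    {P : Measure E} [IsProbabilityMeasure P] {M : ℕ} (hM : 0 < M) {g : S × A → E → ℝ}
    (hg : ∀ p, Measurable (g p)) {ℓ b : ℝ≥0} (hb : ∀ p e, |g p e| ≤ b)
    (hlip : ∀ p q e, |g p e - g q e| ≤ ℓ * D.rho p q) :
    ∫⁻ ω, (⨆ p, ‖empiricalDeviation P M (g p) ω‖ₑ) ^ 2 ∂(Measure.pi fun _ => P) ≤
      64 * (ℓ * D.dudley + ℓ * D.diam + b) ^ 2 / M := by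
  -- If `g p` does not depend on `p`, the diameter and the entropy may be infinite while `ℓ = 0`,
  -- and only the deviation at one point has to be bounded.
  by_cases h0 : ∀ p q, (ℓ : ℝ) * D.rho p q = 0
  · obtain ⟨p₀⟩ := ‹Nonempty (S × A)›
    have hgp : ∀ p, g p = g p₀ := fun p => funext fun e => by
      have := hlip p p₀ e
      rw [h0] at this
      linarith [abs_nonpos_iff.1 this]
    have h1 := lintegral_iSup_enorm_sq_le_of_hasSubgaussianMGF (ι := S × A) (s := {p₀})
      (X := fun p => empiricalDeviation P M (g p)) (Finset.singleton_nonempty p₀) fun p _ =>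
      hasSubgaussianMGF_empiricalDeviation (P := P) hM (hg p) (hb p)
    have h2 : ∀ ω, (⨆ p, ‖empiricalDeviation P M (g p) ω‖ₑ) =
        ⨆ p ∈ ({p₀} : Finset (S × A)), ‖empiricalDeviation P M (g p) ω‖ₑ := by
      intro ω
      have : Nonempty (S × A) := ⟨p₀⟩
      simp [hgp]
    simp only [h2]
    refine h1.trans ?_
    have h3 : ENNReal.ofReal (4 * ((b / NNReal.sqrt M) ^ 2 : ℝ≥0) *
        (1 + Real.log (({p₀} : Finset (S × A)).card : ℝ))) = 4 * (b : ℝ≥0∞) ^ 2 / M := by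
      have hMn : (M : ℝ≥0) ≠ 0 := by exact_mod_cast hM.ne'
      rw [div_pow, NNReal.sq_sqrt]
      simp only [Finset.card_singleton, Nat.cast_one, Real.log_one, add_zero, mul_one]
      rw [ENNReal.ofReal_mul (by norm_num), ENNReal.ofReal_coe_nnreal, ENNReal.coe_div hMn,
        mul_div_assoc]
      simp
    rw [h3]
    refine ENNReal.div_le_div_right ?_ _
    gcongr
    · norm_num
    · exact le_add_self
  push Not at h0
  obtain ⟨p₁, q₁, h0⟩ := h0
  have hℓ : (ℓ : ℝ≥0∞) ≠ 0 := by
    intro h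
    simp only [ENNReal.coe_eq_zero] at h
    simp [h] at h0
  have hdiam0 : D.diam ≠ 0 := by
    intro h
    have h1 : ENNReal.ofReal (D.rho p₁ q₁) ≤ D.diam :=
      le_iSup₂ (f := fun p q => ENNReal.ofReal (D.rho p q)) p₁ q₁
    rw [h, nonpos_iff_eq_zero, ENNReal.ofReal_eq_zero] at h1
    exact h0 (by rw [le_antisymm h1 (D.rho_nonneg _ _), mul_zero])
  have htop : ∀ x : ℝ≥0∞, x = ⊤ → 64 * x ^ 2 / M = ⊤ := by
    rintro x rfl
    rw [ENNReal.top_pow two_ne_zero, ENNReal.mul_top (by norm_num),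
      ENNReal.top_div_of_ne_top (ENNReal.natCast_ne_top M)]
  by_cases hdiam : D.diam = ⊤
  · rw [htop _ (by simp [hdiam, ENNReal.mul_top hℓ])]
    exact le_top
  by_cases hdud : D.dudley = ⊤
  · rw [htop _ (by simp [hdud, ENNReal.mul_top hℓ])]
    exact le_top
  obtain ⟨d, hd⟩ : ∃ d : ℝ≥0, D.diam = d := ⟨D.diam.toNNReal, (ENNReal.coe_toNNReal hdiam).symm⟩
  have hd0 : 0 < d := pos_iff_ne_zero.2 fun h => hdiam0 (by simp [hd, h])
  have hset : {u : ℝ | 0 < u ∧ ENNReal.ofReal u ≤ D.diam} = Set.Ioc 0 (d : ℝ) := by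
    ext u
    simp only [Set.mem_ofPred_eq, Set.mem_Ioc, hd]
    rw [← ENNReal.ofReal_coe_nnreal, ENNReal.ofReal_le_ofReal_iff d.coe_nonneg]
  have hdudley : D.dudley = ∫⁻ u in Set.Ioc 0 (d : ℝ), D.entropyRoot u := by
    rw [← hset]; rfl
  have hρd : ∀ p q, D.rho p q ≤ d := by
    intro p q
    have h1 : ENNReal.ofReal (D.rho p q) ≤ D.diam :=
      le_iSup₂ (f := fun p q => ENNReal.ofReal (D.rho p q)) p q
    rw [hd, ← ENNReal.ofReal_coe_nnreal, ENNReal.ofReal_le_ofReal_iff d.coe_nonneg] at h1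
    exact h1
  -- An infinite covering number at `u` makes the integrand infinite on all of `(0, u]`.
  have hcov : ∀ u : ℝ, 0 < u → u ≤ d → D.coveringNumber u ≠ ⊤ := by
    intro u hu hud h
    apply hdud
    rw [hdudley, eq_top_iff]
    refine le_trans (le_of_eq ?_) (lintegral_mono_set (Set.Ioc_subset_Ioc_right hud))
    symm
    calc ∫⁻ v in Set.Ioc 0 u, D.entropyRoot v = ∫⁻ _ in Set.Ioc 0 u, ⊤ := by
          refine setLIntegral_congr_fun measurableSet_Ioc fun v hv => ?_
          have : D.coveringNumber v = ⊤ := top_le_iff.1 (h ▸ D.coveringNumber_anti hv.2)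
          simp [entropyRoot, this]
      _ = ⊤ := by
          rw [setLIntegral_const, Real.volume_Ioc, ENNReal.top_mul]
          simpa using hu
  have hmain := eLpNorm_iSup_empiricalDeviation_le (P := P) hM hg hb hlip hd0 hρd
    (D.entropyRoot_anti.antitoneOn _) (fun u hu hud => by
      obtain ⟨s, hs, hc⟩ := D.exists_net (hcov u hu hud)
      refine ⟨s, hs, ?_⟩
      rw [entropyRoot, if_neg (hcov u hu hud)]
      refine ENNReal.ofReal_le_ofReal (Real.sqrt_le_sqrt (Real.log_le_log ?_ ?_))
      · obtain ⟨p⟩ := ‹Nonempty (S × A)›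
        obtain ⟨q, hq, -⟩ := hs p
        exact_mod_cast Finset.card_pos.2 ⟨q, hq⟩
      · exact_mod_cast hc)
  have h2 := eLpNorm_nnreal_pow_eq_lintegral (μ := Measure.pi fun _ : Fin M => P)
    (f := fun ω => ⨆ p, ‖empiricalDeviation P M (g p) ω‖ₑ) (p := 2) (by norm_num)
  simp only [enorm_eq_self, NNReal.coe_ofNat, ENNReal.rpow_ofNat, ENNReal.coe_ofNat] at h2
  rw [← h2, hdudley, hd]
  refine (pow_le_pow_left₀ zero_le hmain 2).trans (le_of_eq ?_)
  rw [div_eq_mul_inv, mul_pow, mul_pow, div_eq_mul_inv, ← ENNReal.inv_pow]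
  congr 2
  · norm_num
  · rw [← ENNReal.coe_pow, NNReal.sq_sqrt]
    simp

/-- For an `ℓ`-Lipschitz `f` the two envelopes that define the interpolant lie in
`[f p - 2 ℓ ρ(p, q), f p]` and `[f p, f p + 2 ℓ ρ(p, q)]` for each grid point `q`. -/
theorem abs_interp_sub_le (D : DualSetup S A E) {ℓ : ℝ} {f : S × A → ℝ}
    (hf : ∀ p q, |f p - f q| ≤ ℓ * D.rho p q) (p : S × A) (g : Fin D.L × Fin D.L) :
    |f p - D.interp ℓ f p| ≤ ℓ * D.rho p (D.grid g) := by
  have : Nonempty (Fin D.L × Fin D.L) := ⟨g⟩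
  have h1 : ∀ g, f (D.grid g) - ℓ * D.rho p (D.grid g) ≤ f p := fun g => by
    linarith [(abs_le.1 (hf p (D.grid g))).1]
  have h2 : ∀ g, f p ≤ f (D.grid g) + ℓ * D.rho p (D.grid g) := fun g => by
    linarith [(abs_le.1 (hf p (D.grid g))).2]
  have h3 : (⨆ g, (f (D.grid g) - ℓ * D.rho p (D.grid g))) ≤ f p := ciSup_le h1
  have h4 : f p ≤ ⨅ g, (f (D.grid g) + ℓ * D.rho p (D.grid g)) := le_ciInf h2
  have h5 := le_ciSup (f := fun g => f (D.grid g) - ℓ * D.rho p (D.grid g))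
    (Set.finite_range _).bddAbove g
  have h6 := ciInf_le (f := fun g => f (D.grid g) + ℓ * D.rho p (D.grid g))
    (Set.finite_range _).bddBelow g
  have h7 := h1 g
  have h8 := h2 g
  rw [interp, abs_le]
  constructor <;> linarith

theorem enorm_sub_interp_le (D : DualSetup S A E) (hL : 0 < D.L) {ℓ : ℝ≥0} {f : S × A → ℝ}
    (hf : ∀ p q, |f p - f q| ≤ ℓ * D.rho p q) (p : S × A) :
    ‖f p - D.interp ℓ f p‖ₑ ≤ ℓ * D.coveringRadius := by
  have : Nonempty (Fin D.L) := ⟨⟨0, hL⟩⟩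
  obtain ⟨g, hg⟩ := exists_eq_ciInf_of_finite
    (f := fun g : Fin D.L × Fin D.L => ENNReal.ofReal (D.rho p (D.grid g)))
  have h1 : ENNReal.ofReal (D.rho p (D.grid g)) ≤ D.coveringRadius := by
    rw [hg]
    exact le_iSup (fun p => ⨅ g : Fin D.L × Fin D.L, ENNReal.ofReal (D.rho p (D.grid g))) p
  calc ‖f p - D.interp ℓ f p‖ₑ ≤ ENNReal.ofReal (ℓ * D.rho p (D.grid g)) := by
        rw [Real.enorm_eq_ofReal_abs]
        exact ENNReal.ofReal_le_ofReal (D.abs_interp_sub_le hf p g)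
    _ = ℓ * ENNReal.ofReal (D.rho p (D.grid g)) := by
        rw [ENNReal.ofReal_mul ℓ.coe_nonneg, ENNReal.ofReal_coe_nnreal]
    _ ≤ _ := by gcongr

end Metric

/-! ### The population regression and the change of measure -/

section Projection

variable {S A E : Type*} [MeasurableSpace S] [MeasurableSpace E]

theorem measurable_normψ (D : DualSetup S A E) (hψ : ∀ k, Measurable (D.ψ k)) (k : Fin D.K) :
    Measurable fun e => D.normψ e k := by
  simp only [normψ, Matrix.mulVec, dotProduct]
  fun_prop

/-- Since `ψ = Σ_E (Σ_E⁻¹ ψ)`, a bound on `Σ_E⁻¹ ψ` makes `ψ` itself bounded. -/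
theorem exists_abs_ψ_le (D : DualSetup S A E) (hdet : IsUnit D.gramψ.det)
    (hΛ : ∀ e k, |D.normψ e k| ≤ D.Λψ) : ∃ B : ℝ, ∀ k e, |D.ψ k e| ≤ B := by
  refine ⟨∑ i, ∑ j, |D.gramψ i j| * D.Λψ, fun k e => ?_⟩
  have h1 : D.gramψ.mulVec (D.normψ e) = fun k => D.ψ k e := by
    rw [normψ, Matrix.mulVec_mulVec, Matrix.mul_nonsing_inv _ hdet, Matrix.one_mulVec]
  have h2 : D.ψ k e = ∑ j, D.gramψ k j * D.normψ e j := (congrFun h1 k).symm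
  rw [h2]
  refine (Finset.abs_sum_le_sum_abs _ _).trans ?_
  refine le_trans (Finset.sum_le_sum fun j _ => ?_)
    (Finset.single_le_sum (f := fun i => ∑ j, |D.gramψ i j| * (D.Λψ : ℝ))
      (fun i _ => Finset.sum_nonneg fun j _ => by positivity) (Finset.mem_univ k))
  rw [abs_mul]
  exact mul_le_mul_of_nonneg_left (hΛ e j) (abs_nonneg _)

variable [MeasurableSpace A]

/-- The minimizer of the mean square error is unique and is the solution
`E[V⋆_{t+1}(𝒦_{t+1}(p, ε)) Σ_E⁻¹ ψ(ε)]` of the normal equations. -/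
theorem projCoeff_eq (D : DualSetup S A E) [IsProbabilityMeasure D.noise]
    (hψ : ∀ k, Measurable (D.ψ k)) (hdet : IsUnit D.gramψ.det)
    (hΛ : ∀ e k, |D.normψ e k| ≤ D.Λψ) {t : ℕ} {p : S × A} {v : ℝ}
    (hVm : Measurable fun e => D.Vstar (t + 1) (D.dyn (t + 1) p e))
    (hVb : ∀ e, |D.Vstar (t + 1) (D.dyn (t + 1) p e)| ≤ v) (k : Fin D.K) :
    D.projCoeff t p k = ∫ e, D.Vstar (t + 1) (D.dyn (t + 1) p e) * D.normψ e k ∂D.noise := by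
  obtain ⟨B, hB⟩ := D.exists_abs_ψ_le hdet hΛ
  set V : E → ℝ := fun e => D.Vstar (t + 1) (D.dyn (t + 1) p e) with hV
  set b : Fin D.K → ℝ := fun j => ∫ e, V e * D.ψ j e ∂D.noise with hb
  set c₀ : Fin D.K → ℝ := fun k => ∫ e, V e * D.normψ e k ∂D.noise with hc₀
  have hψψ : ∀ i j, Integrable (fun e => D.ψ i e * D.ψ j e) D.noise := fun i j =>
    integrable_of_abs_le ((hψ i).mul (hψ j)) (b := B * B) fun e => by
      rw [abs_mul]
      exact mul_le_mul (hB i e) (hB j e) (abs_nonneg _) ((abs_nonneg _).trans (hB i e))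
  have hVψ : ∀ j, Integrable (fun e => V e * D.ψ j e) D.noise := fun j =>
    integrable_of_abs_le (hVm.mul (hψ j)) (b := v * B) fun e => by
      rw [abs_mul]
      exact mul_le_mul (hVb e) (hB j e) (abs_nonneg _) ((abs_nonneg _).trans (hVb e))
  have hVV : Integrable (fun e => V e ^ 2) D.noise :=
    integrable_of_abs_le (hVm.pow_const 2) (b := v ^ 2) fun e => by
      rw [abs_pow]
      exact pow_le_pow_left₀ (abs_nonneg _) (hVb e) 2
  have hc₀' : c₀ = D.gramψ⁻¹.mulVec b := by
    ext k
    simp only [hc₀, normψ, Matrix.mulVec, dotProduct, hb]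
    simp_rw [Finset.mul_sum, ← integral_const_mul]
    rw [integral_finsetSum _ fun j _ => ?_]
    · refine Finset.sum_congr rfl fun j _ => ?_
      congr 1; ext e; ring
    · refine ((hVψ j).const_mul (D.gramψ⁻¹ k j)).congr (Filter.Eventually.of_forall fun e => ?_)
      simp only; ring
  have hnormal : ∀ j, ∑ k, D.gramψ j k * c₀ k = b j := by
    have h1 : D.gramψ.mulVec c₀ = b := by
      rw [hc₀', Matrix.mulVec_mulVec, Matrix.mul_nonsing_inv _ hdet, Matrix.one_mulVec]
    exact fun j => congrFun h1 j
  have hlin : ∀ (c : Fin D.K → ℝ), Integrable (fun e => V e * ∑ k, c k * D.ψ k e) D.noise := by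
    intro c
    simp_rw [Finset.mul_sum]
    refine integrable_finsetSum _ fun k _ => ((hVψ k).const_mul (c k)).congr
      (Filter.Eventually.of_forall fun e => ?_)
    simp only; ring
  have hquad : ∀ (c d : Fin D.K → ℝ),
      Integrable (fun e => (∑ k, c k * D.ψ k e) * ∑ j, d j * D.ψ j e) D.noise := by
    intro c d
    simp_rw [Finset.sum_mul_sum]
    refine integrable_finsetSum _ fun k _ => integrable_finsetSum _ fun j _ =>
      ((hψψ k j).const_mul (c k * d j)).congr (Filter.Eventually.of_forall fun e => ?_)
    simp only; ring
  have hlin_eq : ∀ c : Fin D.K → ℝ,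
      ∫ e, V e * ∑ k, c k * D.ψ k e ∂D.noise = ∑ k, c k * b k := by
    intro c
    simp_rw [Finset.mul_sum]
    rw [integral_finsetSum _ fun k _ => ((hVψ k).const_mul (c k)).congr
      (Filter.Eventually.of_forall fun e => by simp only; ring)]
    refine Finset.sum_congr rfl fun k _ => ?_
    rw [hb, ← integral_const_mul]
    congr 1; ext e; ring
  have hquad_eq : ∀ c d : Fin D.K → ℝ,
      ∫ e, (∑ k, c k * D.ψ k e) * ∑ j, d j * D.ψ j e ∂D.noise =
        ∑ k, c k * ∑ j, D.gramψ k j * d j := by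
    intro c d
    simp_rw [Finset.sum_mul_sum]
    rw [integral_finsetSum _ fun k _ => integrable_finsetSum _ fun j _ =>
      ((hψψ k j).const_mul (c k * d j)).congr
        (Filter.Eventually.of_forall fun e => by simp only; ring)]
    refine Finset.sum_congr rfl fun k _ => ?_
    rw [integral_finsetSum _ fun j _ => ((hψψ k j).const_mul (c k * d j)).congr
        (Filter.Eventually.of_forall fun e => by simp only; ring), Finset.mul_sum]
    refine Finset.sum_congr rfl fun j _ => ?_
    rw [gramψ, Matrix.of_apply, mul_comm _ (d j), ← mul_assoc, ← integral_const_mul]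
    congr 1; ext e; ring
  have hpyth : ∀ c, D.projObjective t p c = D.projObjective t p c₀ +
      ∫ e, (∑ k, (c k - c₀ k) * D.ψ k e) ^ 2 ∂D.noise := by
    intro c
    set d : Fin D.K → ℝ := fun k => c k - c₀ k with hd
    have h1 : ∀ e, (V e - ∑ k, c k * D.ψ k e) ^ 2 =
        (V e - ∑ k, c₀ k * D.ψ k e) ^ 2 + (∑ k, d k * D.ψ k e) ^ 2 -
          2 * (V e * (∑ k, d k * D.ψ k e) -
            (∑ k, d k * D.ψ k e) * ∑ k, c₀ k * D.ψ k e) := by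
      intro e
      have : ∑ k, c k * D.ψ k e = ∑ k, c₀ k * D.ψ k e + ∑ k, d k * D.ψ k e := by
        rw [← Finset.sum_add_distrib]
        exact Finset.sum_congr rfl fun k _ => by rw [hd]; ring
      rw [this]; ring
    have i1 : Integrable (fun e => (V e - ∑ k, c₀ k * D.ψ k e) ^ 2) D.noise := by
      refine ((hVV.add (hquad c₀ c₀)).sub ((hlin c₀).const_mul 2)).congr
        (Filter.Eventually.of_forall fun e => ?_)
      simp only [Pi.add_apply, Pi.sub_apply]; ring
    have i2 : Integrable (fun e => (∑ k, d k * D.ψ k e) ^ 2) D.noise := by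
      simpa only [sq] using hquad d d
    have i12 : Integrable (fun e => (V e - ∑ k, c₀ k * D.ψ k e) ^ 2 +
        (∑ k, d k * D.ψ k e) ^ 2) D.noise := i1.add i2
    have i3 : Integrable (fun e => V e * (∑ k, d k * D.ψ k e) -
        (∑ k, d k * D.ψ k e) * ∑ k, c₀ k * D.ψ k e) D.noise := (hlin d).sub (hquad d c₀)
    have h2 : ∫ e, (V e * (∑ k, d k * D.ψ k e) -
        (∑ k, d k * D.ψ k e) * ∑ k, c₀ k * D.ψ k e) ∂D.noise = 0 := by
      rw [integral_sub (hlin d) (hquad d c₀), hlin_eq, hquad_eq]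
      simp [hnormal]
    unfold projObjective
    rw [integral_congr_ae (Filter.Eventually.of_forall h1),
      integral_sub i12 (i3.const_mul 2), integral_const_mul, h2, integral_add i1 i2,
      mul_zero, sub_zero]
  -- A minimizer exists, so `projCoeff` is one; by the Pythagorean identity `hpyth` it differs from
  -- `c₀` by a vector in the kernel of the Gram matrix.
  have hmin : ∃ c, ∀ c', D.projObjective t p c ≤ D.projObjective t p c' :=
    ⟨c₀, fun c' => by
      rw [hpyth c']
      exact le_add_of_nonneg_right (integral_nonneg fun e => sq_nonneg _)⟩
  have hspec : ∀ c', D.projObjective t p (D.projCoeff t p) ≤ D.projObjective t p c' :=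
    Classical.epsilon_spec hmin
  set d : Fin D.K → ℝ := fun k => D.projCoeff t p k - c₀ k with hd
  have hzero : ∫ e, (∑ k, d k * D.ψ k e) ^ 2 ∂D.noise = 0 := by
    have h1 := hspec c₀
    rw [hpyth (D.projCoeff t p)] at h1
    exact le_antisymm (by linarith) (integral_nonneg fun e => sq_nonneg _)
  have hae : ∀ᵐ e ∂D.noise, ∑ k, d k * D.ψ k e = 0 := by
    rw [integral_eq_zero_iff_of_nonneg (fun e => sq_nonneg _)
      (by simpa only [sq] using hquad d d)] at hzero
    filter_upwards [hzero] with e he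
    simpa using he
  have hgd : D.gramψ.mulVec d = 0 := by
    ext j
    have h1 := hquad_eq (Pi.single j 1) d
    rw [integral_congr_ae (g := fun _ => 0)] at h1
    · simpa [Pi.single_apply, Matrix.mulVec, dotProduct] using h1.symm
    · filter_upwards [hae] with e he
      rw [he, mul_zero]
  have hd0 : d = 0 := by
    have h1 : D.gramψ⁻¹.mulVec (D.gramψ.mulVec d) = d := by
      rw [Matrix.mulVec_mulVec, Matrix.nonsing_inv_mul _ hdet, Matrix.one_mulVec]
    rw [← h1, hgd, Matrix.mulVec_zero]
  exact sub_eq_zero.1 (congrFun hd0 k)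

theorem transition_apply (D : DualSetup S A E) [IsProbabilityMeasure D.noise] {h : ℕ}
    (hdyn : Measurable fun z : (S × A) × E => D.dyn h z.1 z.2) (p : S × A) :
    D.transition h p = D.noise.map (D.dyn h p) := by
  rw [transition, Kernel.map_apply _ hdyn, Kernel.prod_apply, Kernel.id_apply, Kernel.const_apply,
    Measure.dirac_prod, Measure.map_map hdyn (by fun_prop)]
  rfl

/-- Change of measure from `P_h(· | p)` to `μ_h`, with the density bounded by its largest essential
supremum. -/
theorem lintegral_dyn_le_densitySup_mul (D : DualSetup S A E) [IsProbabilityMeasure D.noise]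
    {h : ℕ} [IsProbabilityMeasure (D.μ h)]
    (hdyn : Measurable fun z : (S × A) × E => D.dyn h z.1 z.2)
    (hac : ∀ p, D.transition h p ≪ D.μ h) {f : S → ℝ≥0∞} (hf : Measurable f) (p : S × A) :
    ∫⁻ e, f (D.dyn h p e) ∂D.noise ≤ D.densitySup h * ∫⁻ x, f x ∂(D.μ h) := by
  have hp : Measurable (D.dyn h p) := hdyn.comp measurable_prodMk_left
  rw [← lintegral_map hf hp, ← D.transition_apply hdyn]
  have : IsProbabilityMeasure (D.transition h p) := by
    rw [D.transition_apply hdyn]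
    exact Measure.isProbabilityMeasure_map hp.aemeasurable
  rw [← lintegral_rnDeriv_mul (hac p) hf.aemeasurable, ← lintegral_const_mul _ hf]
  refine lintegral_mono_ae ?_
  filter_upwards [ENNReal.ae_le_essSup ((D.transition h p).rnDeriv (D.μ h))] with x hx
  refine mul_le_mul_left (hx.trans ?_) _
  exact le_iSup (fun p => essSup ((D.transition h p).rnDeriv (D.μ h)) (D.μ h)) p

end Projection

end DualSetup

/-! ### Suprema and truncation -/

theorem DenseRange.ciSup_comp_eq {X ι α : Type*} [TopologicalSpace X] [Nonempty ι]
    [ConditionallyCompleteLinearOrder α] [TopologicalSpace α] [OrderClosedTopology α]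
    {u : ι → X} (hu : DenseRange u) {f : X → α} (hf : Continuous f)
    (hb : BddAbove (Set.range f)) : ⨆ i, f (u i) = ⨆ x, f x := by
  have hb' : BddAbove (Set.range fun i => f (u i)) :=
    hb.mono (Set.range_comp_subset_range u f)
  have : Nonempty X := ⟨u (Classical.arbitrary ι)⟩
  refine le_antisymm (ciSup_le fun i => le_ciSup hb (u i)) (ciSup_le fun x => ?_)
  exact hu.induction_on (p := fun x => f x ≤ ⨆ i, f (u i)) x
    (isClosed_le hf continuous_const) fun i => le_ciSup hb' i

/-- The supremum over `a` of `r a + g ω a` is measurable in `ω` although `r` is arbitrary: the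
graph of `r` is separable, and it is enough to take the supremum over a countable dense part
of it. -/
theorem measurable_iSup_add_of_continuous {A Ω : Type*} [TopologicalSpace A]
    [SecondCountableTopology A] [Nonempty A] [MeasurableSpace Ω] (r : A → ℝ) {g : Ω → A → ℝ}
    (hc : ∀ ω, Continuous (g ω)) (hm : ∀ a, Measurable fun ω => g ω a)
    (hb : ∀ ω, BddAbove (Set.range fun a => r a + g ω a)) :
    Measurable fun ω => ⨆ a, (r a + g ω a) := by
  let Γ : Set (A × ℝ) := Set.range fun a => (a, r a)
  have : Nonempty Γ := ⟨⟨_, Set.mem_range_self (Classical.arbitrary A)⟩⟩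
  let F : Ω → Γ → ℝ := fun ω y => y.1.2 + g ω y.1.1
  have hF : ∀ ω, Continuous (F ω) := fun ω =>
    (continuous_snd.comp continuous_subtype_val).add
      ((hc ω).comp (continuous_fst.comp continuous_subtype_val))
  have hrange : ∀ ω, Set.range (F ω) = Set.range fun a => r a + g ω a := by
    intro ω
    ext y
    constructor
    · rintro ⟨⟨_, a, rfl⟩, rfl⟩
      exact ⟨a, rfl⟩
    · rintro ⟨a, rfl⟩
      exact ⟨⟨_, a, rfl⟩, rfl⟩
  have heq : ∀ ω, ⨆ a, (r a + g ω a) = ⨆ n, F ω (TopologicalSpace.denseSeq Γ n) := by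
    intro ω
    rw [(TopologicalSpace.denseRange_denseSeq Γ).ciSup_comp_eq (hF ω) (by rw [hrange]; exact hb ω),
      iSup, iSup, hrange]
  simp_rw [heq]
  exact Measurable.iSup fun n => (hm _).const_add _

theorem abs_ciSup_sub_ciSup_le {ι : Type*} [Nonempty ι] {f g : ι → ℝ} {c : ℝ}
    (hf : BddAbove (Set.range f)) (hg : BddAbove (Set.range g)) (h : ∀ i, |f i - g i| ≤ c) :
    |(⨆ i, f i) - ⨆ i, g i| ≤ c := by
  rw [abs_sub_le_iff]
  constructor
  · rw [sub_le_iff_le_add]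
    refine ciSup_le fun i => ?_
    linarith [(abs_le.1 (h i)).2, le_ciSup hg i]
  · rw [sub_le_iff_le_add]
    refine ciSup_le fun i => ?_
    linarith [(abs_le.1 (h i)).1, le_ciSup hf i]

theorem abs_ciSup_le {ι : Type*} [Nonempty ι] {f : ι → ℝ} {c : ℝ} (h : ∀ i, |f i| ≤ c) :
    |⨆ i, f i| ≤ c := by
  have h1 : BddAbove (Set.range f) := ⟨c, by rintro _ ⟨i, rfl⟩; exact (abs_le.1 (h i)).2⟩
  obtain ⟨i⟩ := ‹Nonempty ι›
  have : Nonempty ι := ⟨i⟩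
  exact abs_le.2 ⟨(abs_le.1 (h i)).1.trans (le_ciSup h1 i), ciSup_le fun i => (abs_le.1 (h i)).2⟩

theorem abs_clip_le {l : ℝ} (hl : 0 ≤ l) (x : ℝ) : |max (-l) (min l x)| ≤ l :=
  abs_le.2 ⟨le_max_left _ _, max_le (by linarith) (min_le_left _ _)⟩

theorem abs_clip_sub_clip_le (l x y : ℝ) :
    |max (-l) (min l x) - max (-l) (min l y)| ≤ |x - y| := by
  refine (abs_max_sub_max_le_max _ _ _ _).trans ?_
  rw [sub_self, abs_zero, max_eq_right (abs_nonneg _)]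
  refine (abs_min_sub_min_le_max _ _ _ _).trans ?_
  rw [sub_self, abs_zero, max_eq_right (abs_nonneg _)]

namespace DualSetup

/-! ### Regularity of the approximate value functions -/

section Primal

variable {S A E : Type*} [MeasurableSpace S] [MeasurableSpace E]

/-- The coefficients `β_a` of the primal regression at time `h`. -/
def primalCoeff (D : DualSetup S A E) (ω : D.PrimalSample) (h : ℕ) (hh : h < D.H) (a : A)
    (k : Fin D.Kpr) : ℝ :=
  (D.N : ℝ)⁻¹ * ∑ i : Fin D.N,
    D.VN ω (h + 1) (D.dyn (h + 1) ((ω ⟨h, hh⟩ i).1, a) (ω ⟨h, hh⟩ i).2) *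
      D.normγ h (ω ⟨h, hh⟩ i).1 k

/-- The truncated estimate `T[β_aᵀ γ(x)]` of the continuation value at time `h`. -/
def primalCont (D : DualSetup S A E) (ω : D.PrimalSample) (h : ℕ) (hh : h < D.H) (x : S)
    (a : A) : ℝ :=
  max (-D.clipLevel (h + 1)) (min (D.clipLevel (h + 1))
    (∑ k, D.primalCoeff ω h hh a k * D.γ k x))

theorem VN_of_lt (D : DualSetup S A E) (ω : D.PrimalSample) {h : ℕ} (hh : h < D.H) (x : S) :
    D.VN ω h x = ⨆ a, (D.R h x a + D.primalCont ω h hh x a) := by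
  rw [VN, dif_pos hh]
  rfl

theorem VN_H (D : DualSetup S A E) (ω : D.PrimalSample) : D.VN ω D.H = D.F := by
  rw [VN, dif_neg (lt_irrefl _)]

theorem clipLevel_nonneg (D : DualSetup S A E) {h : ℕ} (hh : h ≤ D.H) : 0 ≤ D.clipLevel h := by
  have : (h : ℝ) ≤ D.H := by exact_mod_cast hh
  exact mul_nonneg (by linarith) D.Rmax.coe_nonneg

end Primal

section Regularity

variable {S A E : Type*} [MetricSpace S] [MeasurableSpace S]
  [MetricSpace A] [MeasurableSpace A] [MeasurableSpace E]

/-- The standing assumptions on the decision process, on the reference measures and on the two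
regression bases. -/
structure Assumptions (D : DualSetup S A E) : Prop where
  N_pos : 0 < D.N
  L_pos : 0 < D.L
  noise : IsProbabilityMeasure D.noise
  μ_prob : ∀ h ≤ D.H, IsProbabilityMeasure (D.μ h)
  abs_cont : ∀ h, 1 ≤ h → h ≤ D.H → ∀ p, D.transition h p ≪ D.μ h
  dyn_meas : ∀ h, 1 ≤ h → h ≤ D.H → Measurable fun z : (S × A) × E => D.dyn h z.1 z.2
  dyn_lip : ∀ h, 1 ≤ h → h ≤ D.H → ∀ p q e,
    dist (D.dyn h p e) (D.dyn h q e) ≤ D.LK * D.rho p q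
  R_meas : ∀ h < D.H, Measurable fun p : S × A => D.R h p.1 p.2
  R_bound : ∀ h < D.H, ∀ x a, |D.R h x a| ≤ D.Rmax
  F_bound : ∀ x, |D.F x| ≤ D.Rmax
  R_lip : ∀ h < D.H, ∀ x x' a, |D.R h x a - D.R h x' a| ≤ D.LR * dist x x'
  F_lip : ∀ x x', |D.F x - D.F x'| ≤ D.LV * dist x x'
  normγ_bound : ∀ h < D.H, ∀ x k, |D.normγ h x k| ≤ D.Λγ
  γ_lip : ∀ x x', √(∑ k, (D.γ k x - D.γ k x') ^ 2) ≤ D.Lγ * dist x x'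
  ψ_meas : ∀ k, Measurable (D.ψ k)
  gramψ_det : IsUnit D.gramψ.det
  normψ_bound : ∀ e k, |D.normψ e k| ≤ D.Λψ
  ψ_sq : ∫ e, ∑ k, D.ψ k e ^ 2 ∂D.noise ≤ (D.ϱψ : ℝ) ^ 2

namespace Assumptions

variable {D : DualSetup S A E}

theorem nonemptyS (hD : D.Assumptions) : Nonempty S := ⟨D.gridS ⟨0, hD.L_pos⟩⟩

theorem nonemptyA (hD : D.Assumptions) : Nonempty A := ⟨D.gridA ⟨0, hD.L_pos⟩⟩

theorem γ_continuous (hD : D.Assumptions) (k : Fin D.Kpr) : Continuous (D.γ k) := by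
  have : LipschitzWith D.Lγ (D.γ k) := by
    refine LipschitzWith.of_dist_le_mul fun x y => le_trans ?_ (hD.γ_lip x y)
    rw [Real.dist_eq, ← Real.sqrt_sq_eq_abs]
    exact Real.sqrt_le_sqrt (Finset.single_le_sum (f := fun k => (D.γ k x - D.γ k y) ^ 2)
      (fun j _ => sq_nonneg _) (Finset.mem_univ k))
  exact this.continuous

theorem abs_R_add_primalCont_le (hD : D.Assumptions) (ω : D.PrimalSample) {h : ℕ}
    (hh : h < D.H) (x : S) (a : A) : |D.R h x a + D.primalCont ω h hh x a| ≤ D.Vmax := by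
  have h1 := hD.R_bound h hh x a
  have h2 : |D.primalCont ω h hh x a| ≤ D.clipLevel (h + 1) :=
    abs_clip_le (D.clipLevel_nonneg hh) _
  refine (abs_add_le _ _).trans ((add_le_add h1 h2).trans ?_)
  rw [clipLevel, Vmax]
  push_cast
  have : 0 ≤ (h : ℝ) * D.Rmax := by positivity
  nlinarith

theorem abs_VN_le (hD : D.Assumptions) (ω : D.PrimalSample) {h : ℕ} (hh : h ≤ D.H) (x : S) :
    |D.VN ω h x| ≤ D.Vmax := by
  rcases hh.lt_or_eq with hh | rfl
  · have := hD.nonemptyA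
    rw [D.VN_of_lt ω hh]
    exact abs_ciSup_le fun a => hD.abs_R_add_primalCont_le ω hh x a
  · rw [D.VN_H]
    refine (hD.F_bound x).trans ?_
    rw [Vmax]
    push_cast
    have : 0 ≤ (D.H : ℝ) * D.Rmax := by positivity
    linarith

theorem bddAbove_R_add_primalCont (hD : D.Assumptions) (ω : D.PrimalSample) {h : ℕ}
    (hh : h < D.H) (x : S) : BddAbove (Set.range fun a => D.R h x a + D.primalCont ω h hh x a) :=
  ⟨D.Vmax, by rintro _ ⟨a, rfl⟩; exact (abs_le.1 (hD.abs_R_add_primalCont_le ω hh x a)).2⟩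

theorem abs_primalCoeff_le (hD : D.Assumptions) (ω : D.PrimalSample) {h : ℕ} (hh : h < D.H)
    (a : A) (k : Fin D.Kpr) : |D.primalCoeff ω h hh a k| ≤ D.Vmax * D.Λγ := by
  have hle : |∑ i : Fin D.N,
      D.VN ω (h + 1) (D.dyn (h + 1) ((ω ⟨h, hh⟩ i).1, a) (ω ⟨h, hh⟩ i).2) *
        D.normγ h (ω ⟨h, hh⟩ i).1 k| ≤ D.N * (D.Vmax * D.Λγ) := by
    refine (Finset.abs_sum_le_sum_abs _ _).trans ?_
    refine (Finset.sum_le_card_nsmul _ _ ((D.Vmax : ℝ) * D.Λγ) fun i _ => ?_).trans ?_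
    · rw [abs_mul]
      exact mul_le_mul (hD.abs_VN_le ω hh _) (hD.normγ_bound h hh _ k) (abs_nonneg _)
        D.Vmax.coe_nonneg
    · simp
  rw [primalCoeff, abs_mul, abs_of_nonneg (by positivity)]
  rw [inv_mul_le_iff₀ (by exact_mod_cast hD.N_pos)]
  exact hle

/-- Truncation and suprema do not increase Lipschitz constants, and by the Cauchy-Schwarz inequality
the regression term has the constant `V_max Λ_γ L_γ √K_pr`. -/
theorem abs_VN_sub_le (hD : D.Assumptions) (ω : D.PrimalSample) {h : ℕ} (hh : h ≤ D.H)
    (x y : S) : |D.VN ω h x - D.VN ω h y| ≤ D.LV * dist x y := by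
  rcases hh.lt_or_eq with hh | rfl
  swap
  · rw [D.VN_H]
    exact hD.F_lip x y
  have := hD.nonemptyA
  rw [D.VN_of_lt ω hh, D.VN_of_lt ω hh]
  refine abs_ciSup_sub_ciSup_le (hD.bddAbove_R_add_primalCont ω hh x)
    (hD.bddAbove_R_add_primalCont ω hh y) fun a => ?_
  have h1 := hD.R_lip h hh x y a
  have h2 : |D.primalCont ω h hh x a - D.primalCont ω h hh y a| ≤
      D.Vmax * D.Λγ * D.Lγ * √D.Kpr * dist x y := by
    refine (abs_clip_sub_clip_le _ _ _).trans ?_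
    rw [← Finset.sum_sub_distrib]
    simp_rw [← mul_sub]
    have h3 := Finset.sum_mul_sq_le_sq_mul_sq Finset.univ (D.primalCoeff ω h hh a)
      (fun k => D.γ k x - D.γ k y)
    have h4 : ∑ k, D.primalCoeff ω h hh a k ^ 2 ≤ D.Kpr * (D.Vmax * D.Λγ) ^ 2 := by
      refine (Finset.sum_le_card_nsmul _ _ (((D.Vmax : ℝ) * D.Λγ) ^ 2) fun k _ => ?_).trans ?_
      · rw [← sq_abs]
        exact pow_le_pow_left₀ (abs_nonneg _) (hD.abs_primalCoeff_le ω hh a k) 2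
      · simp
    have h5 : √(∑ k, D.primalCoeff ω h hh a k ^ 2) ≤ √D.Kpr * (D.Vmax * D.Λγ) := by
      refine (Real.sqrt_le_sqrt h4).trans (le_of_eq ?_)
      rw [Real.sqrt_mul (by positivity), Real.sqrt_sq (by positivity)]
    calc |∑ k, D.primalCoeff ω h hh a k * (D.γ k x - D.γ k y)|
        ≤ √((∑ k, D.primalCoeff ω h hh a k ^ 2) * ∑ k, (D.γ k x - D.γ k y) ^ 2) :=
          Real.abs_le_sqrt h3
      _ = √(∑ k, D.primalCoeff ω h hh a k ^ 2) * √(∑ k, (D.γ k x - D.γ k y) ^ 2) :=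
          Real.sqrt_mul (Finset.sum_nonneg fun k _ => sq_nonneg _) _
      _ ≤ (√D.Kpr * (D.Vmax * D.Λγ)) * (D.Lγ * dist x y) :=
          mul_le_mul h5 (hD.γ_lip x y) (Real.sqrt_nonneg _) (by positivity)
      _ = _ := by ring
  calc |D.R h x a + D.primalCont ω h hh x a - (D.R h y a + D.primalCont ω h hh y a)|
      = |(D.R h x a - D.R h y a) + (D.primalCont ω h hh x a - D.primalCont ω h hh y a)| := by
        congr 1; ring
    _ ≤ _ := (abs_add_le _ _).trans (add_le_add h1 h2)
    _ = D.LV * dist x y := by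
        rw [LV]
        push_cast
        ring

theorem continuous_VN (hD : D.Assumptions) (ω : D.PrimalSample) {h : ℕ} (hh : h ≤ D.H) :
    Continuous (D.VN ω h) :=
  (LipschitzWith.of_dist_le_mul (K := D.LV) fun x y => by
    rw [Real.dist_eq]; exact hD.abs_VN_sub_le ω hh x y).continuous

theorem abs_VN_dyn_sub_le (hD : D.Assumptions) (ω : D.PrimalSample) {h : ℕ} (h1 : 1 ≤ h)
    (hh : h ≤ D.H) (p q : S × A) (e : E) :
    |D.VN ω h (D.dyn h p e) - D.VN ω h (D.dyn h q e)| ≤ (D.LV * D.LK : ℝ≥0) * D.rho p q := by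
  refine (hD.abs_VN_sub_le ω hh _ _).trans ?_
  push_cast
  rw [mul_assoc]
  exact mul_le_mul_of_nonneg_left (hD.dyn_lip h h1 hh p q e) D.LV.coe_nonneg

variable [BorelSpace S]

theorem measurable_normγ (hD : D.Assumptions) (h : ℕ) (k : Fin D.Kpr) :
    Measurable fun x => D.normγ h x k := by
  have := fun k => (hD.γ_continuous k).measurable
  simp only [normγ, Matrix.mulVec, dotProduct]
  fun_prop

variable [SecondCountableTopology S] [SecondCountableTopology A]

/-- The approximate value functions are jointly measurable in the state and the sample: they are
measurable in the sample for each state, and Lipschitz in the state. -/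
theorem measurable_VN (hD : D.Assumptions) {h : ℕ} (hh : h ≤ D.H) :
    Measurable fun z : S × D.PrimalSample => D.VN z.2 h z.1 := by
  induction hh using Nat.decreasingInduction with
  | self =>
    simp only [D.VN_H]
    have : Continuous D.F :=
      (LipschitzWith.of_dist_le_mul (K := D.LV) fun x y => by
        rw [Real.dist_eq]; exact hD.F_lip x y).continuous
    exact this.measurable.comp measurable_fst
  | of_succ h hh ih =>
    have hh' : h < D.H := hh
    have := hD.nonemptyA
    refine measurable_uncurry_of_continuous_of_measurable (u := fun x ω => D.VN ω h x)
      (fun ω => hD.continuous_VN ω hh'.le) fun x => ?_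
    simp_rw [D.VN_of_lt _ hh']
    refine measurable_iSup_add_of_continuous (D.R h x) (fun ω => ?_) (fun a => ?_)
      fun ω => hD.bddAbove_R_add_primalCont ω hh' x
    · have hcoef : ∀ k, Continuous fun a => D.primalCoeff ω h hh' a k := by
        intro k
        refine continuous_const.mul (continuous_finsetSum _ fun i _ => ?_)
        refine Continuous.mul ?_ continuous_const
        exact (D.continuous_of_abs_sub_le_rho fun p q =>
          hD.abs_VN_dyn_sub_le ω (by omega) hh p q (ω ⟨h, hh'⟩ i).2).comp
            (Continuous.prodMk_right _)
      refine continuous_const.max (continuous_const.min (continuous_finsetSum _ fun k _ => ?_))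
      exact (hcoef k).mul continuous_const
    · have hcoef : ∀ k, Measurable fun ω => D.primalCoeff ω h hh' a k := by
        intro k
        refine Measurable.const_mul (Finset.measurable_fun_sum _ fun i _ => ?_) _
        have hω : Measurable fun ω : D.PrimalSample => ω ⟨h, hh'⟩ i :=
          (measurable_pi_apply i).comp (measurable_pi_apply (⟨h, hh'⟩ : Fin D.H))
        have hX : Measurable fun ω : D.PrimalSample =>
            D.dyn (h + 1) ((ω ⟨h, hh'⟩ i).1, a) (ω ⟨h, hh'⟩ i).2 :=
          (hD.dyn_meas (h + 1) (by omega) hh).comp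
            ((hω.fst.prodMk measurable_const).prodMk hω.snd)
        exact (ih.comp (hX.prodMk measurable_id)).mul ((hD.measurable_normγ h k).comp hω.fst)
      refine measurable_const.max (measurable_const.min (Finset.measurable_fun_sum _ fun k _ => ?_))
      exact (hcoef k).mul measurable_const

end Assumptions

end Regularity

end DualSetup

/-! ### The Bellman recursion -/

/-- A measurable near-maximizer: if `Q x a` is Lipschitz in `x` uniformly in `a` and `S` is
separable, an almost optimal `a` can be chosen constant on each of countably many cells of `S`. -/
theorem exists_measurable_forall_iSup_sub_le {S A : Type*} [MetricSpace S]
    [SecondCountableTopology S] [MeasurableSpace S] [BorelSpace S] [Nonempty S] [Nonempty A]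
    [MeasurableSpace A] {Q : S → A → ℝ} {ℓ : ℝ} (hb : ∀ x, BddAbove (Set.range (Q x)))
    (hlip : ∀ x y a, |Q x a - Q y a| ≤ ℓ * dist x y) {δ : ℝ} (hδ : 0 < δ) :
    ∃ f : S → A, Measurable f ∧ ∀ x, (⨆ a, Q x a) - δ ≤ Q x (f x) := by
  classical
  have h3 : 0 < δ / 3 := by positivity
  have hsel : ∀ y, ∃ a, (⨆ a, Q y a) - δ / 3 < Q y a := fun y =>
    exists_lt_of_lt_ciSup (by linarith)
  choose a ha using hsel
  let u : ℕ → S := TopologicalSpace.denseSeq S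
  have hex : ∀ x, ∃ n, ℓ * dist x (u n) < δ / 3 := by
    intro x
    have hc : Continuous fun y => ℓ * dist x y := by fun_prop
    have ho : IsOpen {y | ℓ * dist x y < δ / 3} := isOpen_lt hc continuous_const
    obtain ⟨n, hn⟩ := (TopologicalSpace.denseRange_denseSeq S).exists_mem_open ho
      ⟨x, by simpa using h3⟩
    exact ⟨n, hn⟩
  refine ⟨fun x => a (u (Nat.find (hex x))), ?_, fun x => ?_⟩
  · refine (measurable_from_nat (f := fun n => a (u n))).comp (measurable_find hex fun k => ?_)
    exact (isOpen_lt (by fun_prop) continuous_const).measurableSet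
  · have hn := Nat.find_spec (hex x)
    set y := u (Nat.find (hex x)) with hy
    have hS : (⨆ a, Q x a) ≤ (⨆ a, Q y a) + δ / 3 := by
      refine ciSup_le fun b => ?_
      linarith [(abs_le.1 (hlip x y b)).2, le_ciSup (hb y) b]
    linarith [ha y, (abs_le.1 (hlip x y (a y))).1]

namespace DualSetup

section Path

variable {S A E : Type*} [MeasurableSpace S] [MeasurableSpace E]

/-- The total reward of a path of `n` steps that starts at time `h`. -/
def pathReward (D : DualSetup S A E) (n h : ℕ) (z : (Fin n → S × A) × S) : ℝ :=
  (∑ i : Fin n, D.R (h + i) (z.1 i).1 (z.1 i).2) + D.F z.2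

theorem pathReward_cons (D : DualSetup S A E) (n h : ℕ) (p : S × A) (z : (Fin n → S × A) × S) :
    D.pathReward (n + 1) h (Fin.cons (α := fun _ => S × A) p z.1, z.2) =
      D.R h p.1 p.2 + D.pathReward n (h + 1) z := by
  simp only [pathReward, Fin.sum_univ_succ, Fin.cons_zero, Fin.cons_succ, Fin.val_zero,
    Fin.val_succ, add_zero]
  rw [add_assoc]
  refine congrArg₂ (· + ·) rfl
    (congrArg₂ (· + ·) (Finset.sum_congr rfl fun i _ => ?_) rfl)
  rw [show h + (↑i + 1) = h + 1 + ↑i by ring]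

theorem clipLevel_le_Vmax (D : DualSetup S A E) {h : ℕ} : D.clipLevel h ≤ D.Vmax := by
  rw [clipLevel, Vmax]
  push_cast
  have : 0 ≤ (h : ℝ) * D.Rmax := by positivity
  nlinarith

/-- The value of the Bellman recursion: `W_H = F` and
`W_h(x) = sup_a (R_h(x, a) + E W_{h+1}(𝒦_{h+1}(x, a, ε)))`. -/
def bellmanValue (D : DualSetup S A E) (h : ℕ) : S → ℝ :=
  if h < D.H then
    fun x => ⨆ a : A, (D.R h x a + ∫ e, bellmanValue D (h + 1) (D.dyn (h + 1) (x, a) e) ∂D.noise)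
  else D.F
termination_by D.H - h

/-- The state-action value `R_h(x, a) + E W_{h+1}(𝒦_{h+1}(x, a, ε))`. -/
def bellmanQ (D : DualSetup S A E) (h : ℕ) (x : S) (a : A) : ℝ :=
  D.R h x a + ∫ e, D.bellmanValue (h + 1) (D.dyn (h + 1) (x, a) e) ∂D.noise

theorem bellmanValue_of_lt (D : DualSetup S A E) {h : ℕ} (hh : h < D.H) (x : S) :
    D.bellmanValue h x = ⨆ a, D.bellmanQ h x a := by
  rw [bellmanValue, if_pos hh]
  rfl

theorem bellmanValue_H (D : DualSetup S A E) : D.bellmanValue D.H = D.F := by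
  rw [bellmanValue, if_neg (lt_irrefl _)]

variable [MeasurableSpace A]

theorem measurable_cons_prod (n : ℕ) :
    Measurable fun z : (S × A) × ((Fin n → S × A) × S) =>
      ((Fin.cons (α := fun _ => S × A) z.1 z.2.1, z.2.2) : (Fin (n + 1) → S × A) × S) := by
  refine Measurable.prodMk (measurable_pi_iff.2 fun i => ?_) (by fun_prop)
  refine Fin.cases ?_ (fun j => ?_) i
  · simpa using measurable_fst
  · simpa [Function.comp_def] using
      (measurable_pi_apply j).comp (measurable_fst.comp measurable_snd)

theorem policyValue_eq_integral_pathReward (D : DualSetup S A E) (π : Policy S A) (h : ℕ)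
    (x : S) :
    D.policyValue π h x = ∫ z, D.pathReward (D.H - h) h z ∂(D.pathKernel π (D.H - h) h x) := rfl

theorem policyValue_H (D : DualSetup S A E) (π : Policy S A) (x : S) (hF : Measurable D.F) :
    D.policyValue π D.H x = D.F x := by
  rw [policyValue_eq_integral_pathReward, Nat.sub_self, pathKernel, Kernel.deterministic_apply,
    show D.pathReward 0 D.H = D.F ∘ Prod.snd by ext z; simp [pathReward],
    integral_dirac' _ _ (hF.comp measurable_snd).stronglyMeasurable]
  rfl

end Path

section Bellman

variable {S A E : Type*} [MetricSpace S] [MeasurableSpace S]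
  [MetricSpace A] [MeasurableSpace A] [MeasurableSpace E]

namespace Assumptions

variable {D : DualSetup S A E}

theorem abs_bellmanQ_le_of (hD : D.Assumptions) {h : ℕ} (hh : h < D.H)
    (ih : ∀ x, |D.bellmanValue (h + 1) x| ≤ D.clipLevel (h + 1)) (x : S) (a : A) :
    |D.bellmanQ h x a| ≤ D.clipLevel h := by
  have := hD.noise
  have h1 := hD.R_bound h hh x a
  have h2 : |∫ e, D.bellmanValue (h + 1) (D.dyn (h + 1) (x, a) e) ∂D.noise| ≤
      D.clipLevel (h + 1) := abs_integral_le_of_abs_le fun e => ih _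
  refine (abs_add_le _ _).trans ((add_le_add h1 h2).trans (le_of_eq ?_))
  rw [clipLevel, clipLevel]
  push_cast
  ring

theorem abs_bellmanValue_le (hD : D.Assumptions) {h : ℕ} (hh : h ≤ D.H) (x : S) :
    |D.bellmanValue h x| ≤ D.clipLevel h := by
  induction hh using Nat.decreasingInduction generalizing x with
  | self =>
    rw [D.bellmanValue_H, clipLevel]
    simpa using hD.F_bound x
  | of_succ h hh ih =>
    have := hD.nonemptyA
    rw [D.bellmanValue_of_lt hh]
    exact abs_ciSup_le fun a => hD.abs_bellmanQ_le_of hh ih x a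

theorem abs_bellmanQ_le (hD : D.Assumptions) {h : ℕ} (hh : h < D.H) (x : S) (a : A) :
    |D.bellmanQ h x a| ≤ D.clipLevel h :=
  hD.abs_bellmanQ_le_of hh (fun y => hD.abs_bellmanValue_le hh y) x a

theorem bddAbove_bellmanQ (hD : D.Assumptions) {h : ℕ} (hh : h < D.H) (x : S) :
    BddAbove (Set.range (D.bellmanQ h x)) :=
  ⟨D.clipLevel h, by rintro _ ⟨a, rfl⟩; exact (abs_le.1 (hD.abs_bellmanQ_le hh x a)).2⟩

theorem measurable_dyn_apply (hD : D.Assumptions) {h : ℕ} (h1 : 1 ≤ h) (hh : h ≤ D.H)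
    (p : S × A) : Measurable (D.dyn h p) :=
  (hD.dyn_meas h h1 hh).comp measurable_prodMk_left

theorem isMarkovKernel_transition (hD : D.Assumptions) {h : ℕ} (h1 : 1 ≤ h) (hh : h ≤ D.H) :
    IsMarkovKernel (D.transition h) := by
  have := hD.noise
  exact Kernel.IsMarkovKernel.map _ (hD.dyn_meas h h1 hh)

theorem isMarkovKernel_pathKernel (hD : D.Assumptions) (π : Policy S A) (n : ℕ) :
    ∀ h, h + n = D.H → IsMarkovKernel (D.pathKernel π n h) := by
  induction n with
  | zero =>
    intro h _
    rw [pathKernel]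
    infer_instance
  | succ n ih =>
    intro h hh
    have := ih (h + 1) (by omega)
    have := hD.isMarkovKernel_transition (h := h + 1) (by omega) (by omega)
    have := π.2 h
    rw [pathKernel]
    exact Kernel.IsMarkovKernel.map _ (measurable_cons_prod n)

theorem abs_pathReward_le (hD : D.Assumptions) {n h : ℕ} (hh : h + n = D.H)
    (z : (Fin n → S × A) × S) : |D.pathReward n h z| ≤ (n + 1) * D.Rmax := by
  have h1 : |∑ i : Fin n, D.R (h + i) (z.1 i).1 (z.1 i).2| ≤ n * D.Rmax := by
    refine (Finset.abs_sum_le_sum_abs _ _).trans ?_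
    refine (Finset.sum_le_card_nsmul _ _ (D.Rmax : ℝ) fun (i : Fin n) _ =>
      hD.R_bound (h + i) (by have := i.2; omega) _ _).trans ?_
    simp
  refine (abs_add_le _ _).trans ((add_le_add h1 (hD.F_bound z.2)).trans (le_of_eq ?_))
  ring

theorem abs_policyValue_le (hD : D.Assumptions) (π : Policy S A) {h : ℕ} (hh : h ≤ D.H) (x : S) :
    |D.policyValue π h x| ≤ ((D.H - h : ℕ) + 1) * D.Rmax := by
  have := hD.isMarkovKernel_pathKernel π (D.H - h) h (by omega)
  exact abs_integral_le_of_abs_le fun z => hD.abs_pathReward_le (by omega) z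

variable [BorelSpace S]

/-- Moving the state with the action and the noise kept fixed (synchronous coupling). -/
theorem bellmanQ_lipschitz_of (hD : D.Assumptions) {h : ℕ} (hh : h < D.H) {ℓ : ℝ≥0}
    (ih : ∀ x y, |D.bellmanValue (h + 1) x - D.bellmanValue (h + 1) y| ≤ ℓ * dist x y)
    (x y : S) (a : A) : |D.bellmanQ h x a - D.bellmanQ h y a| ≤
      (D.LR + ℓ * D.LK * (D.nrm (1, 0)).toNNReal : ℝ≥0) * dist x y := by
  have := hD.noise
  have hWm : Measurable (D.bellmanValue (h + 1)) :=
    (LipschitzWith.of_dist_le_mul (K := ℓ) fun x y => by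
      rw [Real.dist_eq]; exact ih x y).continuous.measurable
  have hint : ∀ x, Integrable
      (fun e => D.bellmanValue (h + 1) (D.dyn (h + 1) (x, a) e)) D.noise := fun x =>
    integrable_of_abs_le (hWm.comp (hD.measurable_dyn_apply (by omega) hh _))
      fun e => hD.abs_bellmanValue_le hh _
  have h2 : |∫ e, (D.bellmanValue (h + 1) (D.dyn (h + 1) (x, a) e) -
      D.bellmanValue (h + 1) (D.dyn (h + 1) (y, a) e)) ∂D.noise| ≤
      ℓ * (D.LK * (dist x y * D.nrm (1, 0))) := by
    refine abs_integral_le_of_abs_le fun e => (ih _ _).trans ?_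
    gcongr
    refine (hD.dyn_lip (h + 1) (by omega) hh _ _ e).trans ?_
    gcongr
    simpa using D.rho_le (x, a) (y, a)
  rw [integral_sub (hint x) (hint y)] at h2
  have h1 := hD.R_lip h hh x y a
  have h3 : ((D.nrm (1, 0)).toNNReal : ℝ) = D.nrm (1, 0) :=
    Real.coe_toNNReal _ (apply_nonneg _ _)
  have h4 : D.bellmanQ h x a - D.bellmanQ h y a = (D.R h x a - D.R h y a) +
      (∫ e, D.bellmanValue (h + 1) (D.dyn (h + 1) (x, a) e) ∂D.noise -
        ∫ e, D.bellmanValue (h + 1) (D.dyn (h + 1) (y, a) e) ∂D.noise) := by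
    rw [bellmanQ, bellmanQ]; ring
  rw [h4]
  refine (abs_add_le _ _).trans ((add_le_add h1 h2).trans (le_of_eq ?_))
  push_cast
  rw [h3]
  ring

theorem exists_bellmanValue_lipschitz (hD : D.Assumptions) {h : ℕ} (hh : h ≤ D.H) :
    ∃ ℓ : ℝ≥0, ∀ x y, |D.bellmanValue h x - D.bellmanValue h y| ≤ ℓ * dist x y := by
  induction hh using Nat.decreasingInduction with
  | self => exact ⟨D.LV, fun x y => by rw [D.bellmanValue_H]; exact hD.F_lip x y⟩
  | of_succ h hh ih =>
    obtain ⟨ℓ, hℓ⟩ := ih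
    have := hD.nonemptyA
    refine ⟨D.LR + ℓ * D.LK * (D.nrm (1, 0)).toNNReal, fun x y => ?_⟩
    rw [D.bellmanValue_of_lt hh, D.bellmanValue_of_lt hh]
    exact abs_ciSup_sub_ciSup_le (hD.bddAbove_bellmanQ hh x) (hD.bddAbove_bellmanQ hh y)
      fun a => hD.bellmanQ_lipschitz_of hh hℓ x y a

theorem exists_bellmanQ_lipschitz (hD : D.Assumptions) {h : ℕ} (hh : h < D.H) :
    ∃ ℓ : ℝ≥0, ∀ x y a, |D.bellmanQ h x a - D.bellmanQ h y a| ≤ ℓ * dist x y := by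
  obtain ⟨ℓ, hℓ⟩ := hD.exists_bellmanValue_lipschitz (h := h + 1) hh
  exact ⟨_, hD.bellmanQ_lipschitz_of hh hℓ⟩

theorem measurable_bellmanValue (hD : D.Assumptions) {h : ℕ} (hh : h ≤ D.H) :
    Measurable (D.bellmanValue h) := by
  obtain ⟨ℓ, hℓ⟩ := hD.exists_bellmanValue_lipschitz hh
  exact (LipschitzWith.of_dist_le_mul (K := ℓ) fun x y => by
    rw [Real.dist_eq]; exact hℓ x y).continuous.measurable

/-! ### Values of policies -/

theorem measurable_pathReward (hD : D.Assumptions) {n h : ℕ} (hh : h + n = D.H) :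
    Measurable (D.pathReward n h) := by
  have hF : Measurable D.F := D.bellmanValue_H ▸ hD.measurable_bellmanValue le_rfl
  refine Measurable.add (Finset.measurable_fun_sum _ fun i _ => ?_) (hF.comp measurable_snd)
  exact (hD.R_meas (h + i) (by have := i.2; omega)).comp
    ((measurable_pi_apply i).comp measurable_fst)

theorem integrable_pathReward (hD : D.Assumptions) {n h : ℕ} (hh : h + n = D.H)
    (P : Measure ((Fin n → S × A) × S)) [IsFiniteMeasure P] : Integrable (D.pathReward n h) P :=
  integrable_of_abs_le (hD.measurable_pathReward hh) (hD.abs_pathReward_le hh)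

/-- The expected reward along a path whose first state-action pair is `p`. -/
theorem integral_pathReward_cons (hD : D.Assumptions) (π : Policy S A) {n h : ℕ}
    (hh : h + (n + 1) = D.H) (p : S × A) :
    ∫ w, D.pathReward (n + 1) h (Fin.cons (α := fun _ => S × A) p w.1, w.2)
        ∂((D.pathKernel π n (h + 1) ∘ₖ D.transition (h + 1)) p) =
      D.R h p.1 p.2 + ∫ e, (∫ z, D.pathReward n (h + 1) z
        ∂(D.pathKernel π n (h + 1) (D.dyn (h + 1) p e))) ∂D.noise := by
  have := hD.noise
  have := hD.isMarkovKernel_pathKernel π n (h + 1) (by omega)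
  have := hD.isMarkovKernel_transition (h := h + 1) (by omega) (by omega)
  have hn : h + 1 + n = D.H := by omega
  simp_rw [D.pathReward_cons]
  rw [integral_add (integrable_const _) (hD.integrable_pathReward hn _),
    Kernel.integral_comp (hD.integrable_pathReward hn _),
    D.transition_apply (hD.dyn_meas (h + 1) (by omega) (by omega)),
    integral_map (hD.measurable_dyn_apply (by omega) (by omega) p).aemeasurable
      (hD.measurable_pathReward hn).stronglyMeasurable.integral_kernel.aestronglyMeasurable]
  simp

theorem measurable_integral_pathReward (hD : D.Assumptions) (π : Policy S A) {n h : ℕ}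
    (hh : h + (n + 1) = D.H) :
    Measurable fun p : S × A => D.R h p.1 p.2 + ∫ e, (∫ z, D.pathReward n (h + 1) z
      ∂(D.pathKernel π n (h + 1) (D.dyn (h + 1) p e))) ∂D.noise := by
  have := hD.noise
  refine (hD.R_meas h (by omega)).add (StronglyMeasurable.measurable ?_)
  exact StronglyMeasurable.integral_prod_right' (ν := D.noise)
    (f := fun z : (S × A) × E => ∫ w, D.pathReward n (h + 1) w
      ∂(D.pathKernel π n (h + 1) (D.dyn (h + 1) z.1 z.2)))
    (((hD.measurable_pathReward (n := n) (h := h + 1)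
      (by omega)).stronglyMeasurable.integral_kernel.measurable.comp
        (hD.dyn_meas (h + 1) (by omega) (by omega))).stronglyMeasurable)

/-- The first step of a path splits off from its expected reward. -/
theorem integral_pathReward_succ (hD : D.Assumptions) (π : Policy S A) {n h : ℕ}
    (hh : h + (n + 1) = D.H) (x : S) :
    ∫ z, D.pathReward (n + 1) h z ∂(D.pathKernel π (n + 1) h x) =
      ∫ a, (D.R h x a + ∫ e, (∫ z, D.pathReward n (h + 1) z
        ∂(D.pathKernel π n (h + 1) (D.dyn (h + 1) (x, a) e))) ∂D.noise) ∂(π.1 h x) := by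
  have := hD.isMarkovKernel_pathKernel π n (h + 1) (by omega)
  have := hD.isMarkovKernel_transition (h := h + 1) (by omega) (by omega)
  have := π.2 h
  have hm := hD.measurable_pathReward hh
  have hint : Integrable (fun z : (S × A) × ((Fin n → S × A) × S) =>
      D.pathReward (n + 1) h (Fin.cons (α := fun _ => S × A) z.1 z.2.1, z.2.2))
      (((Kernel.id ×ₖ π.1 h) ⊗ₖ Kernel.prodMkLeft S
        (D.pathKernel π n (h + 1) ∘ₖ D.transition (h + 1))) x) :=
    integrable_of_abs_le (hm.comp (measurable_cons_prod n)) fun z => hD.abs_pathReward_le hh _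
  have h1 := integral_compProd hint
  simp only [Kernel.prodMkLeft_apply, hD.integral_pathReward_cons π hh] at h1
  rw [pathKernel, Kernel.map_apply _ (measurable_cons_prod n),
    integral_map (measurable_cons_prod n).aemeasurable hm.aestronglyMeasurable]
  refine h1.trans ?_
  rw [Kernel.prod_apply, Kernel.id_apply, Measure.dirac_prod,
    integral_map measurable_prodMk_left.aemeasurable
      (hD.measurable_integral_pathReward π hh).aestronglyMeasurable]

/-- The Bellman recursion for the value of a policy. -/
theorem policyValue_of_lt (hD : D.Assumptions) (π : Policy S A) {h : ℕ} (hh : h < D.H) (x : S) :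
    D.policyValue π h x = ∫ a, (D.R h x a +
      ∫ e, D.policyValue π (h + 1) (D.dyn (h + 1) (x, a) e) ∂D.noise) ∂(π.1 h x) := by
  obtain ⟨n, hn⟩ : ∃ n, h + (n + 1) = D.H := ⟨D.H - h - 1, by omega⟩
  simp_rw [policyValue_eq_integral_pathReward]
  rw [show D.H - h = n + 1 by omega, show D.H - (h + 1) = n by omega]
  exact hD.integral_pathReward_succ π hn x

theorem measurable_policyValue (hD : D.Assumptions) (π : Policy S A) {h : ℕ} (hh : h ≤ D.H) :
    Measurable (D.policyValue π h) :=
  (hD.measurable_pathReward (n := D.H - h) (h := h)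
    (by omega)).stronglyMeasurable.integral_kernel.measurable

theorem integrable_policyValue_dyn (hD : D.Assumptions) (π : Policy S A) {h : ℕ} (h1 : 1 ≤ h)
    (hh : h ≤ D.H) (p : S × A) :
    Integrable (fun e => D.policyValue π h (D.dyn h p e)) D.noise := by
  have := hD.noise
  exact integrable_of_abs_le ((hD.measurable_policyValue π hh).comp
    (hD.measurable_dyn_apply h1 hh p)) fun e => hD.abs_policyValue_le π hh _

theorem integrable_bellmanValue_dyn (hD : D.Assumptions) {h : ℕ} (h1 : 1 ≤ h)
    (hh : h ≤ D.H) (p : S × A) :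
    Integrable (fun e => D.bellmanValue h (D.dyn h p e)) D.noise := by
  have := hD.noise
  exact integrable_of_abs_le ((hD.measurable_bellmanValue hh).comp
    (hD.measurable_dyn_apply h1 hh p)) fun e => hD.abs_bellmanValue_le hh _

theorem measurable_policyQ (hD : D.Assumptions) (π : Policy S A) {h : ℕ} (hh : h < D.H) :
    Measurable fun p : S × A => D.R h p.1 p.2 +
      ∫ e, D.policyValue π (h + 1) (D.dyn (h + 1) p e) ∂D.noise := by
  have := hD.noise
  refine (hD.R_meas h hh).add (StronglyMeasurable.measurable ?_)
  exact StronglyMeasurable.integral_prod_right' (ν := D.noise)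
    (f := fun z : (S × A) × E => D.policyValue π (h + 1) (D.dyn (h + 1) z.1 z.2))
    (((hD.measurable_policyValue π (h := h + 1) hh).comp
      (hD.dyn_meas (h + 1) (by omega) hh)).stronglyMeasurable)

theorem integrable_policyQ (hD : D.Assumptions) (π : Policy S A) {h : ℕ} (hh : h < D.H) (x : S)
    (P : Measure A) [IsFiniteMeasure P] :
    Integrable (fun a => D.R h x a +
      ∫ e, D.policyValue π (h + 1) (D.dyn (h + 1) (x, a) e) ∂D.noise) P := by
  have := hD.noise
  exact integrable_of_abs_le ((hD.measurable_policyQ π hh).comp measurable_prodMk_left) fun a =>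
    (abs_add_le _ _).trans (add_le_add (hD.R_bound h hh x a)
      (abs_integral_le_of_abs_le fun e => hD.abs_policyValue_le π (h := h + 1) hh _))

/-- No policy does better than the Bellman recursion. -/
theorem policyValue_le_bellmanValue (hD : D.Assumptions) (π : Policy S A) {h : ℕ}
    (hh : h ≤ D.H) (x : S) : D.policyValue π h x ≤ D.bellmanValue h x := by
  induction hh using Nat.decreasingInduction generalizing x with
  | self =>
    rw [D.policyValue_H π x (D.bellmanValue_H ▸ hD.measurable_bellmanValue le_rfl),
      D.bellmanValue_H]
  | of_succ h hh ih =>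
    have := π.2 h
    rw [hD.policyValue_of_lt π hh, D.bellmanValue_of_lt hh]
    have h1 : ∀ a, D.R h x a + ∫ e, D.policyValue π (h + 1) (D.dyn (h + 1) (x, a) e) ∂D.noise ≤
        ⨆ a, D.bellmanQ h x a := fun a =>
      le_trans (add_le_add le_rfl (integral_mono
        (hD.integrable_policyValue_dyn π (by omega) hh _)
        (hD.integrable_bellmanValue_dyn (by omega) hh _) fun e => ih _))
        (le_ciSup (hD.bddAbove_bellmanQ hh x) a)
    refine (integral_mono (hD.integrable_policyQ π hh x _) (integrable_const _) h1).trans ?_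
    simp

variable [SecondCountableTopology S]

/-- A deterministic policy that loses at most `δ` in each step attains the solution of the Bellman
recursion up to `(H - h) δ`, for all times and states at once. -/
theorem exists_policy_bellmanValue_sub_le (hD : D.Assumptions) {δ : ℝ} (hδ : 0 < δ) :
    ∃ π : Policy S A, ∀ h ≤ D.H, ∀ x,
      D.bellmanValue h x - (D.H - h : ℝ) * δ ≤ D.policyValue π h x := by
  have := hD.noise
  have := hD.nonemptyA
  have := hD.nonemptyS
  have hsel : ∀ h, ∃ f : S → A, Measurable f ∧
      (h < D.H → ∀ x, D.bellmanValue h x - δ ≤ D.bellmanQ h x (f x)) := by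
    intro h
    by_cases hh : h < D.H
    · obtain ⟨ℓ, hℓ⟩ := hD.exists_bellmanQ_lipschitz hh
      obtain ⟨f, hf, hfQ⟩ := exists_measurable_forall_iSup_sub_le
        (fun x => hD.bddAbove_bellmanQ hh x) hℓ hδ
      exact ⟨f, hf, fun _ x => by rw [D.bellmanValue_of_lt hh]; exact hfQ x⟩
    · exact ⟨fun _ => Classical.arbitrary A, measurable_const, fun h => absurd h hh⟩
  choose f hf hfQ using hsel
  let π : Policy S A := ⟨fun h => Kernel.deterministic (f h) (hf h), fun h => inferInstance⟩
  refine ⟨π, fun h hh => ?_⟩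
  induction hh using Nat.decreasingInduction with
  | self =>
    intro x
    rw [D.policyValue_H π x (D.bellmanValue_H ▸ hD.measurable_bellmanValue le_rfl),
      D.bellmanValue_H]
    simp
  | of_succ h hh ih =>
    intro x
    rw [hD.policyValue_of_lt π hh]
    have hdir : π.1 h x = Measure.dirac (f h x) := Kernel.deterministic_apply (hf h) x
    rw [hdir, integral_dirac' (fun a => D.R h x a +
      ∫ e, D.policyValue π (h + 1) (D.dyn (h + 1) (x, a) e) ∂D.noise) _
      ((hD.measurable_policyQ π hh).comp measurable_prodMk_left).stronglyMeasurable]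
    have h1 := hfQ h hh x
    have h2 : ∫ e, (D.bellmanValue (h + 1) (D.dyn (h + 1) (x, f h x) e) -
        (D.H - (h + 1 : ℕ) : ℝ) * δ) ∂D.noise ≤
        ∫ e, D.policyValue π (h + 1) (D.dyn (h + 1) (x, f h x) e) ∂D.noise :=
      integral_mono ((hD.integrable_bellmanValue_dyn (by omega) hh _).sub (integrable_const _))
        (hD.integrable_policyValue_dyn π (by omega) hh _) fun e => ih _
    rw [integral_sub (hD.integrable_bellmanValue_dyn (by omega) hh _) (integrable_const _)] at h2
    simp only [integral_const, probReal_univ, smul_eq_mul, one_mul] at h2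
    push_cast at h2
    rw [bellmanQ] at h1
    linarith

/-- The optimal value function, a supremum over randomized Markov policies, is the solution of the
Bellman recursion. -/
theorem Vstar_eq_bellmanValue (hD : D.Assumptions) {h : ℕ} (hh : h ≤ D.H) :
    D.Vstar h = D.bellmanValue h := by
  ext x
  have hb : BddAbove (Set.range fun π : Policy S A => D.policyValue π h x) :=
    ⟨D.bellmanValue h x, by rintro _ ⟨π, rfl⟩; exact hD.policyValue_le_bellmanValue π hh x⟩
  obtain ⟨π₀, -⟩ := hD.exists_policy_bellmanValue_sub_le one_pos
  have : Nonempty (Policy S A) := ⟨π₀⟩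
  refine le_antisymm (ciSup_le fun π => hD.policyValue_le_bellmanValue π hh x) ?_
  refine le_of_forall_pos_le_add fun ε hε => ?_
  have hpos : (0 : ℝ) < D.H + 1 := by positivity
  obtain ⟨π, hπ⟩ := hD.exists_policy_bellmanValue_sub_le (div_pos hε hpos)
  have h1 := hπ h hh x
  have h2 : D.policyValue π h x ≤ D.Vstar h x := le_ciSup hb π
  have h3 : (D.H - h : ℝ) * (ε / (D.H + 1)) ≤ ε := by
    rw [mul_div_assoc', div_le_iff₀ hpos]
    have : 0 ≤ (h : ℝ) := by positivity
    nlinarith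
  linarith

theorem measurable_Vstar (hD : D.Assumptions) {h : ℕ} (hh : h ≤ D.H) : Measurable (D.Vstar h) :=
  hD.Vstar_eq_bellmanValue hh ▸ hD.measurable_bellmanValue hh

theorem abs_Vstar_le (hD : D.Assumptions) {h : ℕ} (hh : h ≤ D.H) (x : S) :
    |D.Vstar h x| ≤ D.Vmax := by
  rw [hD.Vstar_eq_bellmanValue hh]
  exact (hD.abs_bellmanValue_le hh x).trans D.clipLevel_le_Vmax

end Assumptions

end Bellman

end DualSetup

/-! ### The three parts of the error -/

theorem enorm_integral_sq_le {Ω : Type*} [MeasurableSpace Ω] {P : Measure Ω}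
    [IsProbabilityMeasure P] {f : Ω → ℝ} (hf : Measurable f) :
    ‖∫ x, f x ∂P‖ₑ ^ 2 ≤ ∫⁻ x, ‖f x‖ₑ ^ 2 ∂P := by
  have h1 : ‖∫ x, f x ∂P‖ₑ ≤ eLpNorm f 2 P := by
    refine (enorm_integral_le_lintegral_enorm f).trans ?_
    rw [← eLpNorm_one_eq_lintegral_enorm]
    exact eLpNorm_le_eLpNorm_of_exponent_le (by norm_num) hf.aestronglyMeasurable
  have h2 := eLpNorm_nnreal_pow_eq_lintegral (μ := P) (f := f) (p := 2) (by norm_num)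
  simp only [NNReal.coe_ofNat, ENNReal.rpow_ofNat, ENNReal.coe_ofNat] at h2
  rw [← h2]
  exact pow_le_pow_left₀ zero_le h1 2

theorem enorm_add_three_sq_le (a b c : ℝ) :
    ‖a + b + c‖ₑ ^ 2 ≤ 3 * (‖a‖ₑ ^ 2 + ‖b‖ₑ ^ 2 + ‖c‖ₑ ^ 2) := by
  simp only [Real.enorm_eq_ofReal_abs]
  simp only [← ENNReal.ofReal_pow (abs_nonneg _), sq_abs]
  rw [← ENNReal.ofReal_add (by positivity) (by positivity),
    ← ENNReal.ofReal_add (by positivity) (by positivity),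
    show (3 : ℝ≥0∞) = ENNReal.ofReal 3 by simp, ← ENNReal.ofReal_mul (by norm_num)]
  refine ENNReal.ofReal_le_ofReal ?_
  nlinarith [sq_nonneg (a - b), sq_nonneg (b - c), sq_nonneg (a - c)]

theorem enorm_sum_mul_sq_le {ι : Type*} [Fintype ι] (d w : ι → ℝ) :
    ‖∑ k, d k * w k‖ₑ ^ 2 ≤ ENNReal.ofReal (∑ k, w k ^ 2) * ∑ k, ‖d k‖ₑ ^ 2 := by
  simp only [Real.enorm_eq_ofReal_abs]
  simp only [← ENNReal.ofReal_pow (abs_nonneg _), sq_abs]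
  rw [← ENNReal.ofReal_sum_of_nonneg fun k _ => sq_nonneg _,
    ← ENNReal.ofReal_mul (Finset.sum_nonneg fun k _ => sq_nonneg _), mul_comm]
  exact ENNReal.ofReal_le_ofReal (Finset.sum_mul_sq_le_sq_mul_sq _ _ _)

namespace DualSetup

section Parts

variable {S A E : Type*} [MeasurableSpace S] [MeasurableSpace E]

/-- The Lipschitz constant `L_V L_𝒦 Λ_ψ` of the coefficient functions. -/
abbrev coeffLip (D : DualSetup S A E) : ℝ≥0 := D.LV * D.LK * D.Λψ

/-- The integrand `V_{t+1,N}(𝒦_{t+1}(x, a, ε)) (Σ_E⁻¹ ψ(ε))_k` of the Monte Carlo coefficients. -/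
def mcIntegrand (D : DualSetup S A E) (t : Fin D.H) (ω : D.PrimalSample)
    (k : Fin D.K) (p : S × A) (e : E) : ℝ :=
  D.VN ω (t + 1) (D.dyn (t + 1) p e) * D.normψ e k

theorem mcCoeff_eq (D : DualSetup S A E) (t : Fin D.H) (ω : D.PrimalSample × D.DualSample)
    (k : Fin D.K) (p : S × A) :
    D.mcCoeff t ω k p = (D.M : ℝ)⁻¹ * ∑ m, D.mcIntegrand t ω.1 k p (ω.2 t m) := rfl

/-- The largest deviation, over all state-action pairs, of the `k`-th Monte Carlo coefficient
computed from the draws `v` from its conditional expectation given the primal sample `ω`. -/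
def mcDeviation (D : DualSetup S A E) (t : Fin D.H) (k : Fin D.K)
    (ω : D.PrimalSample) (v : Fin D.M → E) : ℝ≥0∞ :=
  ⨆ p : S × A, ‖empiricalDeviation D.noise D.M (D.mcIntegrand t ω k p) v‖ₑ

variable [MeasurableSpace A]

/-- The squared error of the approximate value function in `L²(μ_{t+1})`, given the sample. -/
def valueError (D : DualSetup S A E) (t : Fin D.H)
    (ω : D.PrimalSample × D.DualSample) : ℝ≥0∞ :=
  ∫⁻ x, ‖D.Vstar (t + 1) x - D.VN ω.1 (t + 1) x‖ₑ ^ 2 ∂(D.μ (t + 1))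

end Parts

namespace Assumptions

variable {S A E : Type*} [MetricSpace S] [MeasurableSpace S] [MetricSpace A] [MeasurableSpace A]
  [MeasurableSpace E] {D : DualSetup S A E}

theorem abs_mcIntegrand_le (hD : D.Assumptions) (t : Fin D.H) (ω : D.PrimalSample)
    (k : Fin D.K) (p : S × A) (e : E) :
    |D.mcIntegrand t ω k p e| ≤ (D.Vmax * D.Λψ : ℝ≥0) := by
  rw [mcIntegrand, abs_mul]
  push_cast
  exact mul_le_mul (hD.abs_VN_le ω t.2 _) (hD.normψ_bound e k) (abs_nonneg _)
    D.Vmax.coe_nonneg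

theorem abs_mcIntegrand_sub_le (hD : D.Assumptions) (t : Fin D.H) (ω : D.PrimalSample)
    (k : Fin D.K) (p q : S × A) (e : E) :
    |D.mcIntegrand t ω k p e - D.mcIntegrand t ω k q e| ≤ D.coeffLip * D.rho p q := by
  rw [mcIntegrand, mcIntegrand, ← sub_mul, abs_mul]
  have h1 := hD.abs_VN_dyn_sub_le ω (by omega) (show (t : ℕ) + 1 ≤ D.H from t.2) p q e
  refine (mul_le_mul h1 (hD.normψ_bound e k) (abs_nonneg _)
    (mul_nonneg (NNReal.coe_nonneg _) (D.rho_nonneg p q))).trans (le_of_eq ?_)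
  push_cast
  ring

theorem abs_mcCoeff_sub_le (hD : D.Assumptions) (hM : 0 < D.M) (t : Fin D.H)
    (ω : D.PrimalSample × D.DualSample) (k : Fin D.K) (p q : S × A) :
    |D.mcCoeff t ω k p - D.mcCoeff t ω k q| ≤ D.coeffLip * D.rho p q := by
  have hM' : (0 : ℝ) < D.M := by exact_mod_cast hM
  rw [mcCoeff_eq, mcCoeff_eq, ← mul_sub, ← Finset.sum_sub_distrib, abs_mul, abs_inv,
    abs_of_pos hM', inv_mul_le_iff₀ hM']
  refine (Finset.abs_sum_le_sum_abs _ _).trans ?_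
  refine (Finset.sum_le_card_nsmul _ _ _ fun m _ =>
    hD.abs_mcIntegrand_sub_le t ω.1 k p q _).trans ?_
  simp

theorem isProbabilityMeasure_μ (hD : D.Assumptions) (h : Fin D.H) :
    IsProbabilityMeasure (D.μ h) := hD.μ_prob h h.2.le

theorem isProbabilityMeasure_simLaw (hD : D.Assumptions) : IsProbabilityMeasure D.simLaw := by
  have := hD.noise
  have := hD.isProbabilityMeasure_μ
  unfold simLaw
  infer_instance

theorem lintegral_ψ_sq_le (hD : D.Assumptions) :
    ∫⁻ e, ENNReal.ofReal (∑ k, D.ψ k e ^ 2) ∂D.noise ≤ (D.ϱψ : ℝ≥0∞) ^ 2 := by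
  have := hD.noise
  obtain ⟨B, hB⟩ := D.exists_abs_ψ_le hD.gramψ_det hD.normψ_bound
  have hint : Integrable (fun e => ∑ k, D.ψ k e ^ 2) D.noise :=
    integrable_finsetSum _ fun k _ => integrable_of_abs_le ((hD.ψ_meas k).pow_const 2)
      (b := B ^ 2) fun e => by
        rw [abs_pow]
        exact pow_le_pow_left₀ (abs_nonneg _) (hB k e) 2
  rw [← ofReal_integral_eq_lintegral_ofReal hint
    (Filter.Eventually.of_forall fun e => Finset.sum_nonneg fun k _ => sq_nonneg _)]
  refine (ENNReal.ofReal_le_ofReal hD.ψ_sq).trans (le_of_eq ?_)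
  rw [ENNReal.ofReal_pow D.ϱψ.coe_nonneg, ENNReal.ofReal_coe_nnreal]

variable [SecondCountableTopology S] [BorelSpace S] [SecondCountableTopology A]

theorem measurable_mcIntegrand (hD : D.Assumptions) (t : Fin D.H) (k : Fin D.K) (p : S × A) :
    Measurable fun z : D.PrimalSample × E => D.mcIntegrand t z.1 k p z.2 := by
  have ht : (t : ℕ) + 1 ≤ D.H := t.2
  refine Measurable.mul ?_ ((D.measurable_normψ hD.ψ_meas k).comp measurable_snd)
  exact (hD.measurable_VN ht).comp
    (((hD.measurable_dyn_apply (by omega) ht p).comp measurable_snd).prodMk measurable_fst)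

theorem measurable_mcIntegrand_apply (hD : D.Assumptions) (t : Fin D.H) (ω : D.PrimalSample)
    (k : Fin D.K) (p : S × A) : Measurable (D.mcIntegrand t ω k p) :=
  (hD.measurable_mcIntegrand t k p).comp measurable_prodMk_left

/-- The deviation is continuous in the state-action pair, so its supremum is one over a countable
dense set. -/
theorem measurable_mcDeviation (hD : D.Assumptions) (hM : 0 < D.M) (t : Fin D.H) (k : Fin D.K) :
    Measurable fun z : D.PrimalSample × (Fin D.M → E) => D.mcDeviation t k z.1 z.2 := by
  have := hD.noise
  have := hD.nonemptyS
  have := hD.nonemptyA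
  have hcont : ∀ (ω : D.PrimalSample) (v : Fin D.M → E), Continuous fun p : S × A =>
      empiricalDeviation D.noise D.M (D.mcIntegrand t ω k p) v := by
    intro ω v
    have hint : ∀ p, Integrable (D.mcIntegrand t ω k p) D.noise := fun p =>
      integrable_of_abs_le (hD.measurable_mcIntegrand_apply t ω k p)
        (hD.abs_mcIntegrand_le t ω k p)
    refine D.continuous_of_abs_sub_le_rho (ℓ := 2 * D.coeffLip) fun p q => ?_
    rw [← empiricalDeviation_sub (hint p) (hint q)]
    refine (abs_empiricalDeviation_le hM (hD.abs_mcIntegrand_sub_le t ω k p q) _).trans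
      (le_of_eq ?_)
    push_cast
    ring
  have hmeas : ∀ p : S × A, Measurable fun z : D.PrimalSample × (Fin D.M → E) =>
      empiricalDeviation D.noise D.M (D.mcIntegrand t z.1 k p) z.2 := by
    intro p
    have h0 := hD.measurable_mcIntegrand t k p
    refine Measurable.sub (Measurable.const_mul (Finset.measurable_fun_sum _ fun m _ => ?_) _) ?_
    · exact h0.comp (measurable_fst.prodMk ((measurable_pi_apply m).comp measurable_snd))
    · have h1 : StronglyMeasurable fun ω : D.PrimalSample =>
          ∫ e, D.mcIntegrand t ω k p e ∂D.noise :=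
        StronglyMeasurable.integral_prod_right' (ν := D.noise) h0.stronglyMeasurable
      exact h1.measurable.comp measurable_fst
  have heq : ∀ z : D.PrimalSample × (Fin D.M → E), D.mcDeviation t k z.1 z.2 =
      ⨆ n, ‖empiricalDeviation D.noise D.M
        (D.mcIntegrand t z.1 k (TopologicalSpace.denseSeq (S × A) n)) z.2‖ₑ := fun z =>
    ((TopologicalSpace.denseRange_denseSeq (S × A)).ciSup_comp_eq
      (hcont z.1 z.2).enorm (OrderTop.bddAbove _)).symm
  simp_rw [heq]
  exact Measurable.iSup fun n => (hmeas _).enorm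

theorem measurable_mcDeviation_sample (hD : D.Assumptions) (hM : 0 < D.M) (t : Fin D.H)
    (k : Fin D.K) :
    Measurable fun ω : D.PrimalSample × D.DualSample => D.mcDeviation t k ω.1 (ω.2 t) := by
  have ht : Measurable fun v : D.DualSample => v t := measurable_pi_apply t
  have hg : Measurable fun ω : D.PrimalSample × D.DualSample => (ω.1, ω.2 t) :=
    measurable_fst.prodMk (ht.comp measurable_snd)
  have hcomp := (hD.measurable_mcDeviation hM t k).comp hg
  simp only [Function.comp_def] at hcomp
  exact hcomp

/-- The stochastic part of the error, by chaining conditionally on the primal sample. -/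
theorem lintegral_mcDeviation_sq_le (hD : D.Assumptions) (hM : 0 < D.M) (t : Fin D.H)
    (k : Fin D.K) :
    ∫⁻ ω, D.mcDeviation t k ω.1 (ω.2 t) ^ 2 ∂D.simLaw ≤
      64 * (D.coeffLip * D.dudley + D.coeffLip * D.diam + (D.Vmax * D.Λψ : ℝ≥0)) ^ 2 / D.M := by
  have := hD.noise
  have := hD.isProbabilityMeasure_μ
  have := hD.nonemptyS
  have := hD.nonemptyA
  have hm := hD.measurable_mcDeviation_sample hM t k
  set c := 64 * (D.coeffLip * D.dudley + D.coeffLip * D.diam + (D.Vmax * D.Λψ : ℝ≥0)) ^ 2 / D.M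
  rw [simLaw, lintegral_prod _ (hm.pow_const 2).aemeasurable]
  refine (lintegral_mono (g := fun _ => c) fun ωp => ?_).trans (by simp)
  have hmain : ∫⁻ v, D.mcDeviation t k ωp v ^ 2 ∂(Measure.pi fun _ => D.noise) ≤ c :=
    D.lintegral_iSup_empiricalDeviation_sq_le (P := D.noise) hM
      (hD.measurable_mcIntegrand_apply t ωp k) (hD.abs_mcIntegrand_le t ωp k)
      (hD.abs_mcIntegrand_sub_le t ωp k)
  have hf : Measurable fun v => D.mcDeviation t k ωp v ^ 2 :=
    ((hD.measurable_mcDeviation hM t k).comp measurable_prodMk_left).pow_const 2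
  have hev := (measurePreserving_eval
    (fun _ : Fin D.H => Measure.pi fun _ : Fin D.M => D.noise) t).lintegral_comp hf
  exact hev.le.trans hmain

theorem measurable_valueDiff (hD : D.Assumptions) (t : Fin D.H) :
    Measurable fun z : S × (D.PrimalSample × D.DualSample) =>
      D.Vstar (t + 1) z.1 - D.VN z.2.1 (t + 1) z.1 := by
  have ht : (t : ℕ) + 1 ≤ D.H := t.2
  exact ((hD.measurable_Vstar ht).comp measurable_fst).sub
    ((hD.measurable_VN ht).comp (measurable_fst.prodMk (measurable_fst.comp measurable_snd)))

theorem measurable_valueError (hD : D.Assumptions) (t : Fin D.H) :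
    Measurable (D.valueError t) := by
  have := hD.μ_prob (t + 1) t.2
  exact ((hD.measurable_valueDiff t).enorm.pow_const 2).lintegral_prod_left'

theorem lintegral_valueError (hD : D.Assumptions) (t : Fin D.H) :
    ∫⁻ ω, D.valueError t ω ∂D.simLaw = D.primalError (t + 1) ^ 2 := by
  have := hD.μ_prob (t + 1) t.2
  have := hD.isProbabilityMeasure_simLaw
  have h2 := eLpNorm_nnreal_pow_eq_lintegral (μ := (D.μ (t + 1)).prod D.simLaw)
    (f := fun z : S × (D.PrimalSample × D.DualSample) =>
      D.Vstar (t + 1) z.1 - D.VN z.2.1 (t + 1) z.1) (p := 2) (by norm_num)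
  simp only [NNReal.coe_ofNat, ENNReal.rpow_ofNat, ENNReal.coe_ofNat] at h2
  rw [primalError, h2, lintegral_prod_symm _
    ((hD.measurable_valueDiff t).enorm.pow_const 2).aemeasurable]
  rfl

/-- The bias of the coefficients that comes from the approximate value function, by a change of
measure. -/
theorem enorm_projCoeff_sub_integral_sq_le (hD : D.Assumptions) (t : Fin D.H)
    (ω : D.PrimalSample × D.DualSample) (k : Fin D.K) (p : S × A) :
    ‖D.projCoeff t p k - ∫ e, D.mcIntegrand t ω.1 k p e ∂D.noise‖ₑ ^ 2 ≤
      (D.Λψ : ℝ≥0∞) ^ 2 * (D.densitySup (t + 1) * D.valueError t ω) := by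
  have := hD.noise
  have ht : (t : ℕ) + 1 ≤ D.H := t.2
  have := hD.μ_prob (t + 1) ht
  have hdyn := hD.measurable_dyn_apply (by omega) ht p
  have hV := (hD.measurable_Vstar ht).comp hdyn
  have hψ := D.measurable_normψ hD.ψ_meas k
  have hdiff : Measurable fun x => D.Vstar (t + 1) x - D.VN ω.1 (t + 1) x :=
    (hD.measurable_valueDiff t).comp (measurable_id.prodMk measurable_const)
  have hint1 : Integrable (fun e => D.Vstar (t + 1) (D.dyn (t + 1) p e) * D.normψ e k) D.noise :=
    integrable_of_abs_le (hV.mul hψ) (b := D.Vmax * D.Λψ) fun e => by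
      rw [abs_mul]
      exact mul_le_mul (hD.abs_Vstar_le ht _) (hD.normψ_bound e k) (abs_nonneg _)
        D.Vmax.coe_nonneg
  have hint2 : Integrable (D.mcIntegrand t ω.1 k p) D.noise :=
    integrable_of_abs_le (hD.measurable_mcIntegrand_apply t ω.1 k p)
      (hD.abs_mcIntegrand_le t ω.1 k p)
  rw [D.projCoeff_eq hD.ψ_meas hD.gramψ_det hD.normψ_bound hV
    (fun e => hD.abs_Vstar_le ht _) k, ← integral_sub hint1 hint2]
  have heq : ∀ e, D.Vstar (t + 1) (D.dyn (t + 1) p e) * D.normψ e k - D.mcIntegrand t ω.1 k p e =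
      (D.Vstar (t + 1) (D.dyn (t + 1) p e) - D.VN ω.1 (t + 1) (D.dyn (t + 1) p e)) *
        D.normψ e k := fun e => by rw [mcIntegrand]; ring
  simp_rw [heq]
  refine (enorm_integral_sq_le ((hdiff.comp hdyn).mul hψ)).trans ?_
  have hdens := D.lintegral_dyn_le_densitySup_mul (hD.dyn_meas _ (by omega) ht)
    (hD.abs_cont _ (by omega) ht) (hdiff.enorm.pow_const 2) p
  refine le_trans ?_ (mul_le_mul_right hdens _)
  have hsq : Measurable fun e => ‖D.Vstar (t + 1) (D.dyn (t + 1) p e) -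
      D.VN ω.1 (t + 1) (D.dyn (t + 1) p e)‖ₑ ^ 2 := (hdiff.enorm.pow_const 2).comp hdyn
  rw [← lintegral_const_mul _ hsq]
  refine lintegral_mono fun e => ?_
  simp only [Pi.mul_apply, Function.comp_apply, enorm_mul, mul_pow]
  rw [mul_comm]
  gcongr
  rw [enorm_le_coe]
  exact_mod_cast hD.normψ_bound e k

/-- The squared error of one interpolated coefficient is at most three times the sum of the squares
of its bias, its stochastic part and its interpolation error. -/
theorem enorm_projCoeff_sub_interp_sq_le (hD : D.Assumptions) (hM : 0 < D.M) (t : Fin D.H)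
    (ω : D.PrimalSample × D.DualSample) (k : Fin D.K) (p : S × A) :
    ‖D.projCoeff t p k - D.interp (D.LV * D.LK * D.Λψ) (D.mcCoeff t ω k) p‖ₑ ^ 2 ≤
      3 * ((D.Λψ : ℝ≥0∞) ^ 2 * (D.densitySup (t + 1) * D.valueError t ω) +
        D.mcDeviation t k ω.1 (ω.2 t) ^ 2 + (D.coeffLip * D.coveringRadius) ^ 2) := by
  have h1 := hD.enorm_projCoeff_sub_integral_sq_le t ω k p
  have h2 : ‖∫ e, D.mcIntegrand t ω.1 k p e ∂D.noise - D.mcCoeff t ω k p‖ₑ ^ 2 ≤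
      D.mcDeviation t k ω.1 (ω.2 t) ^ 2 := by
    refine pow_le_pow_left₀ zero_le ?_ 2
    rw [mcCoeff_eq, ← enorm_neg, neg_sub]
    exact le_iSup (fun p => ‖empiricalDeviation D.noise D.M
      (D.mcIntegrand t ω.1 k p) (ω.2 t)‖ₑ) p
  have h3 : ‖D.mcCoeff t ω k p - D.interp (D.LV * D.LK * D.Λψ) (D.mcCoeff t ω k) p‖ₑ ^ 2 ≤
      (D.coeffLip * D.coveringRadius) ^ 2 := by
    refine pow_le_pow_left₀ zero_le ?_ 2
    have := D.enorm_sub_interp_le hD.L_pos (hD.abs_mcCoeff_sub_le hM t ω k) p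
    simpa using this
  rw [show D.projCoeff t p k - D.interp (D.LV * D.LK * D.Λψ) (D.mcCoeff t ω k) p =
    (D.projCoeff t p k - ∫ e, D.mcIntegrand t ω.1 k p e ∂D.noise) +
      (∫ e, D.mcIntegrand t ω.1 k p e ∂D.noise - D.mcCoeff t ω k p) +
      (D.mcCoeff t ω k p - D.interp (D.LV * D.LK * D.Λψ) (D.mcCoeff t ω k) p) by ring]
  refine (enorm_add_three_sq_le _ _ _).trans (mul_le_mul_right ?_ 3)
  exact add_le_add (add_le_add h1 h2) h3

/-- The bound separates into a factor that depends on the noise variable and one that depends on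
the sample, uniformly in the state-action pair. -/
theorem enorm_eta_sub_etaTilde_sq_le (hD : D.Assumptions) (hM : 0 < D.M) (t : Fin D.H)
    (ω : D.PrimalSample × D.DualSample) (p : S × A) (e : E) :
    ‖D.eta t p e - D.etaTilde t ω p e‖ₑ ^ 2 ≤ ENNReal.ofReal (∑ k, D.ψ k e ^ 2) *
      ∑ k, 3 * ((D.Λψ : ℝ≥0∞) ^ 2 * (D.densitySup (t + 1) * D.valueError t ω) +
        D.mcDeviation t k ω.1 (ω.2 t) ^ 2 + (D.coeffLip * D.coveringRadius) ^ 2) := by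
  rw [eta, etaTilde, ← Finset.sum_sub_distrib]
  simp_rw [← sub_mul]
  refine (enorm_sum_mul_sq_le _ _).trans (mul_le_mul_right (Finset.sum_le_sum fun k _ => ?_) _)
  exact hD.enorm_projCoeff_sub_interp_sq_le hM t ω k p

theorem lintegral_iSup_enorm_eta_sub_etaTilde_sq_le (hD : D.Assumptions) (hM : 0 < D.M)
    (t : Fin D.H) :
    ∫⁻ z, ⨆ p : S × A, ‖D.eta t p z.1 - D.etaTilde t z.2 p z.1‖ₑ ^ 2
        ∂(D.noise.prod D.simLaw) ≤
      192 * ((D.ϱψ : ℝ≥0∞) ^ 2 * (D.K * (D.LV * D.LK * D.dudley + D.LV * D.LK * D.diam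
              + D.Vmax) ^ 2 * (D.Λψ : ℝ≥0∞) ^ 2 / D.M)
        + D.K * (D.Λψ : ℝ≥0∞) ^ 2 * (D.ϱψ : ℝ≥0∞) ^ 2 * D.densitySup (t + 1)
            * D.primalError (t + 1) ^ 2
        + D.K * (D.ϱψ : ℝ≥0∞) ^ 2 * (D.LV : ℝ≥0∞) ^ 2 * (D.LK : ℝ≥0∞) ^ 2
            * (D.Λψ : ℝ≥0∞) ^ 2 * D.coveringRadius ^ 2) := by
  have := hD.noise
  have := hD.isProbabilityMeasure_simLaw
  set δ := D.densitySup (t + 1) with hδ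
  set r := D.coveringRadius with hr
  have hval := hD.measurable_valueError t
  have hdev := fun k => (hD.measurable_mcDeviation_sample hM t k).pow_const 2
  have hbias : Measurable fun ω => (D.Λψ : ℝ≥0∞) ^ 2 * (δ * D.valueError t ω) :=
    (hval.const_mul _).const_mul _
  have hsum : ∀ k, Measurable fun ω => (D.Λψ : ℝ≥0∞) ^ 2 * (δ * D.valueError t ω) +
      D.mcDeviation t k ω.1 (ω.2 t) ^ 2 := fun k => hbias.add (hdev k)
  have hpart : ∀ k, Measurable fun ω => 3 * ((D.Λψ : ℝ≥0∞) ^ 2 * (δ * D.valueError t ω) +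
      D.mcDeviation t k ω.1 (ω.2 t) ^ 2 + (D.coeffLip * r) ^ 2) := fun k =>
    ((hsum k).add_const _).const_mul _
  have hψ : Measurable fun e => ENNReal.ofReal (∑ k, D.ψ k e ^ 2) :=
    (Finset.measurable_fun_sum _ fun k _ => (hD.ψ_meas k).pow_const 2).ennreal_ofReal
  have hk : ∀ k, ∫⁻ ω, 3 * ((D.Λψ : ℝ≥0∞) ^ 2 * (δ * D.valueError t ω) +
      D.mcDeviation t k ω.1 (ω.2 t) ^ 2 + (D.coeffLip * r) ^ 2) ∂D.simLaw ≤
      3 * ((D.Λψ : ℝ≥0∞) ^ 2 * (δ * D.primalError (t + 1) ^ 2) +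
        64 * (D.coeffLip * D.dudley + D.coeffLip * D.diam + (D.Vmax * D.Λψ : ℝ≥0)) ^ 2 / D.M +
        (D.coeffLip * r) ^ 2) := by
    intro k
    rw [lintegral_const_mul _ ((hsum k).add_const _),
      lintegral_add_right _ measurable_const, lintegral_add_left hbias,
      lintegral_const_mul _ (hval.const_mul _), lintegral_const_mul _ hval,
      hD.lintegral_valueError, lintegral_const, measure_univ, mul_one]
    gcongr
    exact hD.lintegral_mcDeviation_sq_le hM t k
  calc ∫⁻ z, ⨆ p : S × A, ‖D.eta t p z.1 - D.etaTilde t z.2 p z.1‖ₑ ^ 2 ∂(D.noise.prod D.simLaw)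
      ≤ ∫⁻ z, ENNReal.ofReal (∑ k, D.ψ k z.1 ^ 2) *
          ∑ k, 3 * ((D.Λψ : ℝ≥0∞) ^ 2 * (δ * D.valueError t z.2) +
            D.mcDeviation t k z.2.1 (z.2.2 t) ^ 2 + (D.coeffLip * r) ^ 2)
          ∂(D.noise.prod D.simLaw) :=
        lintegral_mono fun z => iSup_le fun p => hD.enorm_eta_sub_etaTilde_sq_le hM t z.2 p z.1
    _ = (∫⁻ e, ENNReal.ofReal (∑ k, D.ψ k e ^ 2) ∂D.noise) *
          ∫⁻ ω, ∑ k, 3 * ((D.Λψ : ℝ≥0∞) ^ 2 * (δ * D.valueError t ω) +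
            D.mcDeviation t k ω.1 (ω.2 t) ^ 2 + (D.coeffLip * r) ^ 2) ∂D.simLaw :=
        lintegral_prod_mul hψ.aemeasurable
          (Finset.measurable_fun_sum _ fun k _ => hpart k).aemeasurable
    _ ≤ (D.ϱψ : ℝ≥0∞) ^ 2 * ∑ _k : Fin D.K,
          3 * ((D.Λψ : ℝ≥0∞) ^ 2 * (δ * D.primalError (t + 1) ^ 2) +
            64 * (D.coeffLip * D.dudley + D.coeffLip * D.diam + (D.Vmax * D.Λψ : ℝ≥0)) ^ 2 / D.M +
            (D.coeffLip * r) ^ 2) := by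
        rw [lintegral_finsetSum _ fun k _ => hpart k]
        exact mul_le_mul' hD.lintegral_ψ_sq_le (Finset.sum_le_sum fun k _ => hk k)
    _ = 192 * ((D.ϱψ : ℝ≥0∞) ^ 2 * (D.K * (D.LV * D.LK * D.dudley + D.LV * D.LK * D.diam
            + D.Vmax) ^ 2 * (D.Λψ : ℝ≥0∞) ^ 2 / D.M))
        + 3 * (D.K * (D.Λψ : ℝ≥0∞) ^ 2 * (D.ϱψ : ℝ≥0∞) ^ 2 * δ * D.primalError (t + 1) ^ 2)
        + 3 * (D.K * (D.ϱψ : ℝ≥0∞) ^ 2 * (D.LV : ℝ≥0∞) ^ 2 * (D.LK : ℝ≥0∞) ^ 2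
            * (D.Λψ : ℝ≥0∞) ^ 2 * r ^ 2) := by
        rw [Finset.sum_const, Finset.card_univ, Fintype.card_fin, nsmul_eq_mul, coeffLip]
        push_cast
        simp only [div_eq_mul_inv]
        ring
    _ ≤ 192 * ((D.ϱψ : ℝ≥0∞) ^ 2 * (D.K * (D.LV * D.LK * D.dudley + D.LV * D.LK * D.diam
            + D.Vmax) ^ 2 * (D.Λψ : ℝ≥0∞) ^ 2 / D.M))
        + 192 * (D.K * (D.Λψ : ℝ≥0∞) ^ 2 * (D.ϱψ : ℝ≥0∞) ^ 2 * δ * D.primalError (t + 1) ^ 2)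
        + 192 * (D.K * (D.ϱψ : ℝ≥0∞) ^ 2 * (D.LV : ℝ≥0∞) ^ 2 * (D.LK : ℝ≥0∞) ^ 2
            * (D.Λψ : ℝ≥0∞) ^ 2 * r ^ 2) := by
        gcongr <;> norm_num
    _ = _ := by ring

end Assumptions

end DualSetup

end

theorem mainTheorem2 :
    ∃ C : ℝ≥0, ∀ (S : Type*) (A : Type*) (E : Type*)
      [MetricSpace S] [SecondCountableTopology S] [MeasurableSpace S] [BorelSpace S]
      [MetricSpace A] [SecondCountableTopology A] [MeasurableSpace A] [BorelSpace A]
      [MeasurableSpace E]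
      (D : DualSetup S A E)
      -- sizes
      (_ : 0 < D.N) (_ : 0 < D.M) (_ : 0 < D.L) (_ : 0 < D.K) (_ : 0 < D.Kpr)
      -- the noise law and the reference measures
      (_ : IsProbabilityMeasure D.noise)
      (_ : ∀ h ≤ D.H, IsProbabilityMeasure (D.μ h))
      (_ : ∀ h, 1 ≤ h → h ≤ D.H → ∀ p, D.transition h p ≪ D.μ h)
      -- `ρ` is a metric that comes from a norm on `ℝ²`
      (_ : ∀ v, D.nrm v = 0 → v = 0)
      (_ : ∀ p q r, D.rho p r ≤ D.rho p q + D.rho q r)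
      -- the maps driving the process
      (_ : ∀ h, 1 ≤ h → h ≤ D.H → Measurable fun z : (S × A) × E => D.dyn h z.1 z.2)
      (_ : ∀ h, 1 ≤ h → h ≤ D.H → ∀ p q e, dist (D.dyn h p e) (D.dyn h q e) ≤ D.LK * D.rho p q)
      -- the rewards
      (_ : ∀ h < D.H, Measurable fun p : S × A => D.R h p.1 p.2)
      (_ : ∀ h < D.H, ∀ x a, |D.R h x a| ≤ D.Rmax)
      (_ : ∀ x, |D.F x| ≤ D.Rmax)
      (_ : ∀ h < D.H, ∀ x x' a, |D.R h x a - D.R h x' a| ≤ D.LR * dist x x')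
      (_ : ∀ x x', |D.F x - D.F x'| ≤ D.LV * dist x x')
      -- the primal basis
      (_ : ∀ h < D.H, IsUnit (D.gramγ h).det)
      (_ : ∀ h < D.H, ∀ x k, |D.normγ h x k| ≤ D.Λγ)
      (_ : ∀ x x', √(∑ k, (D.γ k x - D.γ k x') ^ 2) ≤ D.Lγ * dist x x')
      -- the dual basis
      (_ : ∀ k, Measurable (D.ψ k))
      (_ : ∀ k, ∫ e, D.ψ k e ∂D.noise = 0)
      (_ : IsUnit D.gramψ.det)
      (_ : ∀ e k, |D.normψ e k| ≤ D.Λψ)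
      (_ : ∫ e, ∑ k, D.ψ k e ^ 2 ∂D.noise ≤ (D.ϱψ : ℝ) ^ 2)
      (t : Fin D.H),
      ∫⁻ z, ⨆ p : S × A, ‖D.eta t p z.1 - D.etaTilde t z.2 p z.1‖ₑ ^ 2
          ∂(D.noise.prod D.simLaw) ≤
        C * ((D.ϱψ : ℝ≥0∞) ^ 2 * (D.K * (D.LV * D.LK * D.dudley + D.LV * D.LK * D.diam
                + D.Vmax) ^ 2 * (D.Λψ : ℝ≥0∞) ^ 2 / D.M)
          + D.K * (D.Λψ : ℝ≥0∞) ^ 2 * (D.ϱψ : ℝ≥0∞) ^ 2 * D.densitySup (t + 1)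
              * D.primalError (t + 1) ^ 2
          + D.K * (D.ϱψ : ℝ≥0∞) ^ 2 * (D.LV : ℝ≥0∞) ^ 2 * (D.LK : ℝ≥0∞) ^ 2
              * (D.Λψ : ℝ≥0∞) ^ 2 * D.coveringRadius ^ 2) := by
  refine ⟨192, ?_⟩
  intro S A E _ _ _ _ _ _ _ _ _ D hN hM hL _ _ hnoise hμ hac _ _ hdyn hdynL hR hRb hFb hRL hFL
    _ hγΛ hγL hψ _ hψdet hψΛ hψsq t
  have hD : D.Assumptions := {
    N_pos := hN
    L_pos := hL
    noise := hnoise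
    μ_prob := hμ
    abs_cont := hac
    dyn_meas := hdyn
    dyn_lip := hdynL
    R_meas := hR
    R_bound := hRb
    F_bound := hFb
    R_lip := hRL
    F_lip := hFL
    normγ_bound := hγΛ
    γ_lip := hγL
    ψ_meas := hψ
    gramψ_det := hψdet
    normψ_bound := hψΛ
    ψ_sq := hψsq }
  simpa using hD.lintegral_iSup_enorm_eta_sub_etaTilde_sq_le hM t
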